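/- For a finite simple graph $H$ of order $m$, let $P(H,x)$ be its chromatic polynomial, i.e. the polynomial such that $P(H,k)$ is the number of proper $k$-colorings of $H$ for every positive integer $k$, and define the numbers $a_i(H)$ by $$P(H,x)=\sum_{i=0}^{m}(-1)^{m-i}a_i(H)\,x^i,$$ with $a_i(H)=0$ for $i>m$. Let $G=(V,E)$ be a finite simple graph of order $n$ that is not complete, and let $c$ be the number of connected components of $G$. For $u\in V$ let $G-u$ be the subgraph of $G$ induced by $V\setminus\{u\}$, and for $i=1,2,\dots,n$ put $$d_i=\sum_{u\in V}\bigl[a_{i-1}(G-u)+(n-1)\,a_i(G-u)\bigr]-n\,a_i(G).$$ Then $d_i\ge 0$ for every $i=1,2,\dots,n$, and $d_i=0$ holds if and only if at least one of the following holds: 1. $i=n$; 2. $1\le i\le c-2$; 3. $i=c-1$ and $G$ has no isolated vertices; 4. $i=c=1$ and $G$ is isomorphic to the cycle $C_n$ on $n$ vertices. -/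

import Mathlib

open Polynomial

namespace ChromaticCoeff

universe u

/-- Functions on the vertices that are constant along every edge of `H` are the functions on the
connected components of `H`. -/
theorem card_edgeConstant {V : Type u} [Finite V] (H : SimpleGraph V) (k : ℕ) :
    Nat.card {f : V → Fin k // ∀ v w, H.Adj v w → f v = f w} =
      k ^ Nat.card H.ConnectedComponent := by
  have e : {f : V → Fin k // ∀ v w, H.Adj v w → f v = f w} ≃ (H.ConnectedComponent → Fin k) :=
    { toFun := fun f => SimpleGraph.ConnectedComponent.lift f.1 (by
        intro v w p hp
        clear hp
        induction p with
        | nil => rfl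
        | cons h p ih => exact (f.2 _ _ h).trans ih)
      invFun := fun g => ⟨fun v => g (H.connectedComponentMk v), fun v w h =>
        congrArg g (SimpleGraph.ConnectedComponent.sound h.reachable)⟩
      left_inv := fun f => by ext v; rfl
      right_inv := fun g => by
        funext c
        induction c using SimpleGraph.ConnectedComponent.ind
        rfl }
  rw [Nat.card_congr e, Nat.card_fun, Nat.card_fin]

open Classical in
/-- The number of proper `k`-colorings is a polynomial function of `k`. -/
theorem card_coloring_eq_sum {V : Type u} [Finite V] (G : SimpleGraph V) (k : ℕ) :
    (Nat.card (G.Coloring (Fin k)) : ℤ) =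
      ∑ A ∈ (Set.toFinite G.edgeSet).toFinset.powerset, (-1 : ℤ) ^ A.card *
        (k : ℤ) ^ Nat.card (SimpleGraph.fromEdgeSet (A : Set (Sym2 V))).ConnectedComponent := by
  have : Fintype V := Fintype.ofFinite V
  let m : (V → Fin k) → Sym2 V → ℤ := fun f e =>
    if (e.map f).IsDiag then 1 else 0
  have hcol : (Nat.card (G.Coloring (Fin k)) : ℤ) =
      ∑ f : V → Fin k, ∏ e ∈ (Set.toFinite G.edgeSet).toFinset, (1 - m f e) := by
    have e : G.Coloring (Fin k) ≃ {f : V → Fin k // ∀ v w, G.Adj v w → f v ≠ f w} :=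
      { toFun := fun C => ⟨C, fun v w h => C.valid h⟩
        invFun := fun f => SimpleGraph.Coloring.mk f.1 (fun {v w} h => f.2 v w h)
        left_inv := fun C => by ext v; rfl
        right_inv := fun f => rfl }
    rw [Nat.card_congr e, Nat.card_eq_fintype_card, Fintype.card_subtype, Finset.card_filter,
      Nat.cast_sum]
    refine Finset.sum_congr rfl fun f _ => ?_
    split_ifs with h
    · rw [Finset.prod_eq_one, Nat.cast_one]
      intro e he
      induction e using Sym2.ind with
      | _ v w =>
        have := h v w (by simpa using he)
        simp [m, this]
    · push Not at h
      obtain ⟨v, w, hvw, hf⟩ := h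
      rw [Finset.prod_eq_zero (i := s(v, w)) (by simpa using hvw) (by simp [m, hf])]
      rfl
  rw [hcol]
  simp_rw [Finset.prod_sub, Finset.prod_const_one, mul_one]
  rw [Finset.sum_comm]
  refine Finset.sum_congr rfl fun A hA => ?_
  rw [← Finset.mul_sum]
  congr 1
  rw [← Nat.cast_pow, ← card_edgeConstant, Nat.card_eq_fintype_card, Fintype.card_subtype,
    Finset.card_filter, Nat.cast_sum]
  refine Finset.sum_congr rfl fun f _ => ?_
  split_ifs with h
  · rw [Finset.prod_eq_one, Nat.cast_one]
    intro e he
    induction e using Sym2.ind with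
    | _ v w =>
      have hG : G.Adj v w := by simpa using Finset.mem_powerset.1 hA he
      have := h v w (by simp [SimpleGraph.fromEdgeSet_adj, hG.ne, he])
      simp [m, this]
  · push Not at h
    obtain ⟨v, w, hvw, hf⟩ := h
    rw [SimpleGraph.fromEdgeSet_adj] at hvw
    rw [Finset.prod_eq_zero (i := s(v, w)) (by simpa using hvw.1) (by simp [m, hf])]
    rfl

/-- There is exactly one polynomial whose value at every positive integer `k` is the number of
proper `k`-colorings. -/
theorem existsUnique_chromaticPolynomial {V : Type u} [Finite V] (G : SimpleGraph V) :
    ∃! P : ℤ[X], ∀ k : ℕ, 1 ≤ k → P.eval (k : ℤ) = (Nat.card (G.Coloring (Fin k)) : ℤ) := by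
  refine ⟨∑ A ∈ (Set.toFinite G.edgeSet).toFinset.powerset, (-1 : ℤ[X]) ^ A.card *
    X ^ Nat.card (SimpleGraph.fromEdgeSet (A : Set (Sym2 V))).ConnectedComponent, ?_, ?_⟩
  · intro k _
    rw [card_coloring_eq_sum]
    simp [eval_finsetSum]
  · intro Q hQ
    refine Polynomial.eq_of_infinite_eval_eq _ _ ?_
    refine Set.Infinite.mono (s := (fun k : ℕ => (k : ℤ)) '' Set.Ici 1) ?_
      ((Set.Ici_infinite 1).image Nat.cast_injective.injOn)
    rintro _ ⟨k, hk, rfl⟩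
    simp only [Set.mem_ofPred_eq]
    rw [hQ k hk, card_coloring_eq_sum]
    simp [eval_finsetSum]

/-- The chromatic polynomial `P(G, x)`: the polynomial with `P(G, k)` the number of proper
`k`-colorings of `G` for every positive integer `k`. -/
noncomputable def chromaticPolynomial {V : Type u} [Finite V] (G : SimpleGraph V) : ℤ[X] :=
  (existsUnique_chromaticPolynomial G).choose

theorem chromaticPolynomial_eval {V : Type u} [Finite V] (G : SimpleGraph V) (k : ℕ)
    (hk : 1 ≤ k) :
    (chromaticPolynomial G).eval (k : ℤ) = (Nat.card (G.Coloring (Fin k)) : ℤ) :=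
  (existsUnique_chromaticPolynomial G).choose_spec.1 k hk

/-- The number `a_i(G)` in `P(G, x) = ∑ i, (-1) ^ (n - i) * a_i(G) * x ^ i`, where `n` is the order
of `G`. For `i > n` the coefficient of `x ^ i`, and hence `a_i(G)`, is zero. -/
noncomputable def a {V : Type u} [Finite V] (G : SimpleGraph V) (i : ℕ) : ℤ :=
  (-1) ^ (Nat.card V - i) * (chromaticPolynomial G).coeff i

/-- The graph `G - u`, the subgraph induced by all vertices other than `u`. -/
abbrev deleteVertex {V : Type u} (G : SimpleGraph V) (u : V) :
    SimpleGraph ({u}ᶜ : Set V) :=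
  G.induce ({u}ᶜ : Set V)

/-- The number `d_i = ∑ u, [a_{i-1}(G-u) + (n-1) a_i(G-u)] - n a_i(G)`, for `1 ≤ i`. -/
noncomputable def d {V : Type u} [Fintype V] (G : SimpleGraph V) (i : ℕ) : ℤ :=
  ∑ u : V, (a (deleteVertex G u) (i - 1) + ((Nat.card V : ℤ) - 1) * a (deleteVertex G u) i) -
    (Nat.card V : ℤ) * a G i

end ChromaticCoeff

/-!
Fix a set `N` of roots and a vertex set `S`, and count the proper colorings of `G[S]` that avoid one
color on `N`. Deleting a root from `N`, or removing it from `S` and making its neighbors roots,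
gives a recurrence showing that the coefficients of the resulting polynomial alternate in sign, and
that the `j`th one is nonzero exactly when `G[S]` has a set of `j` vertices which together with `N`
meets every component.

Choosing a root `r` in all possible ways and splitting off the part `T` that hangs on `r` gives
`n * a (i + 1) G = ∑ T, |T| * a 1 G[T] * a i (G - T)`, and therefore
`d (i + 1) G = ∑ T, d 1 G[T] * a i (G - T)`. The number `d 1 G[T]` is again a sum of quantities
that obey the deletion recurrence, and these are nonnegative. So every summand is nonnegative, and
`d (i + 1) G` vanishes if and only if every summand does.

A nonzero summand is found by choosing `T` well: a connected set together with a vertex not adjacent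
to it, or a connected set together with two nonadjacent vertices that are both adjacent to it. A
connected noncomplete graph in which deleting two nonadjacent vertices never leaves a nonempty
connected graph is 2-regular, hence a cycle.
-/

namespace ChromaticCoeff

theorem eq_of_eval_add_one {P Q : ℤ[X]}
    (h : ∀ k : ℕ, P.eval ((k : ℤ) + 1) = Q.eval ((k : ℤ) + 1)) : P = Q := by
  refine eq_of_infinite_eval_eq _ _ ((Set.infinite_range_of_injective
    (f := fun k : ℕ => (k : ℤ) + 1) fun k l hkl => by simpa using hkl).mono ?_)
  rintro _ ⟨k, rfl⟩
  exact h k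

/-- Deleting a root `v` from `N` or from `S`, and choosing a new root when `N` misses `S`, are the
deletion and contraction steps for colorings of `G[S]` that avoid one color on `N`. -/
theorem rooted_induction {V : Type*} [DecidableEq V] (G : SimpleGraph V)
    {p : Set V → Finset V → Prop} (empty : ∀ N, p N ∅)
    (disjoint : ∀ N S, S.Nonempty → Disjoint N ↑S →
      (∀ r ∈ S, p (G.neighborSet r) (S.erase r)) → p N S)
    (mem : ∀ N S, ∀ v ∈ N, v ∈ S → p (N \ {v}) S →
      p (N ∪ G.neighborSet v) (S.erase v) → p N S)
    (N : Set V) (S : Finset V) : p N S := by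
  induction hs : S.card using Nat.strong_induction_on generalizing N S with
  | _ s ih_card =>
    subst hs
    induction hm : (N ∩ ↑S).ncard using Nat.strong_induction_on generalizing N with
    | _ m ih_roots =>
      subst hm
      by_cases hd : Disjoint N (S : Set V)
      · rcases S.eq_empty_or_nonempty with rfl | hne
        · exact empty N
        · exact disjoint N S hne hd fun r hr =>
            ih_card _ (Finset.card_erase_lt_of_mem hr) _ _ rfl
      · obtain ⟨v, hN, hS⟩ := Set.not_disjoint_iff.1 hd
        have hlt : ((N \ {v}) ∩ ↑S).ncard < (N ∩ ↑S).ncard :=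
          Set.ncard_lt_ncard ((Set.inter_subset_inter_left _ Set.sdiff_subset).ssubset_of_mem_notMem
            ⟨hN, hS⟩ (by simp)) (S.finite_toSet.inter_of_right N)
        exact mem N S v hN hS (ih_roots _ hlt _ rfl)
          (ih_card _ (Finset.card_erase_lt_of_mem hS) _ _ rfl)

section RootedPolynomial

variable {V : Type*} [Fintype V] [DecidableEq V]

open Classical in
/-- The proper colorings of `G[S]` with the colors `0, …, k` that avoid the color `0` on `N`. They
are encoded as functions on all of `V` that vanish outside `S`; only `N ∩ S` matters. -/
noncomputable def rootedColorings (G : SimpleGraph V) (N : Set V) (S : Finset V) (k : ℕ) :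
    Finset (V → Fin (k + 1)) :=
  Finset.univ.filter fun f => (∀ v ∉ S, f v = 0) ∧
    (∀ v ∈ S, ∀ w ∈ S, G.Adj v w → f v ≠ f w) ∧ ∀ v ∈ S, v ∈ N → f v ≠ 0

variable {G : SimpleGraph V} {N N' : Set V} {S : Finset V} {v : V}

theorem mem_rootedColorings {k : ℕ} {f : V → Fin (k + 1)} :
    f ∈ rootedColorings G N S k ↔ (∀ v ∉ S, f v = 0) ∧
      (∀ v ∈ S, ∀ w ∈ S, G.Adj v w → f v ≠ f w) ∧ ∀ v ∈ S, v ∈ N → f v ≠ 0 := by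
  simp [rootedColorings]

theorem rootedColorings_congr (h : ∀ v ∈ S, v ∈ N ↔ v ∈ N') (k : ℕ) :
    rootedColorings G N S k = rootedColorings G N' S k := by
  ext f
  simp only [mem_rootedColorings]
  exact and_congr_right fun _ => and_congr_right fun _ =>
    forall₂_congr fun v hv => by rw [h v hv]

theorem card_rootedColorings_empty (k : ℕ) : (rootedColorings G N ∅ k).card = 1 := by
  refine Finset.card_eq_one.2 ⟨fun _ => 0, ?_⟩
  ext f
  simp [mem_rootedColorings, funext_iff]

theorem filter_rootedColorings_eq_zero (hv : v ∈ S) (hN : v ∉ N) (k : ℕ) :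
    (rootedColorings G N S k).filter (fun f => f v = 0) =
      rootedColorings G (N ∪ G.neighborSet v) (S.erase v) k := by
  ext f
  simp only [Finset.mem_filter, mem_rootedColorings, Finset.mem_erase, Set.mem_union,
    SimpleGraph.mem_neighborSet]
  constructor
  · rintro ⟨⟨hout, hproper, hroot⟩, hf⟩
    refine ⟨fun w hw => ?_, fun w hw x hx => hproper w hw.2 x hx.2, ?_⟩
    · rcases eq_or_ne w v with rfl | hwv
      · exact hf
      · exact hout w fun h => hw ⟨hwv, h⟩
    · rintro w hw (hwN | hvw)
      · exact hroot w hw.2 hwN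
      · exact hf ▸ hproper w hw.2 v hv hvw.symm
  · rintro ⟨hout, hproper, hroot⟩
    have hf : f v = 0 := hout v fun h => h.1 rfl
    refine ⟨⟨fun w hw => hout w fun h => hw h.2, fun w hw x hx hwx => ?_, fun w hw hwN =>
      hroot w ⟨ne_of_mem_of_not_mem hwN hN, hw⟩ (Or.inl hwN)⟩, hf⟩
    rcases eq_or_ne w v with rfl | hwv
    · exact hf ▸ (hroot x ⟨hwx.ne', hx⟩ (Or.inr hwx)).symm
    rcases eq_or_ne x v with rfl | hxv
    · exact hf ▸ hroot w ⟨hwv, hw⟩ (Or.inr hwx.symm)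
    · exact hproper w ⟨hwv, hw⟩ x ⟨hxv, hx⟩ hwx

theorem filter_rootedColorings_ne_zero (hN : v ∈ N) (hS : v ∈ S) (k : ℕ) :
    (rootedColorings G (N \ {v}) S k).filter (fun f => ¬f v = 0) = rootedColorings G N S k := by
  ext f
  simp only [Finset.mem_filter, mem_rootedColorings, Set.mem_sdiff, Set.mem_singleton_iff]
  constructor
  · rintro ⟨⟨hout, hproper, hroot⟩, hf⟩
    refine ⟨hout, hproper, fun w hw hwN => ?_⟩
    rcases eq_or_ne w v with rfl | hwv
    · exact hf
    · exact hroot w hw ⟨hwN, hwv⟩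
  · rintro ⟨hout, hproper, hroot⟩
    exact ⟨⟨hout, hproper, fun w hw hwN => hroot w hw hwN.1⟩, hroot v hS hN⟩

theorem card_rootedColorings_diff_singleton (hN : v ∈ N) (hS : v ∈ S) (k : ℕ) :
    (rootedColorings G (N \ {v}) S k).card = (rootedColorings G N S k).card +
      (rootedColorings G (N ∪ G.neighborSet v) (S.erase v) k).card := by
  rw [← Finset.card_filter_add_card_filter_not (s := rootedColorings G (N \ {v}) S k)
    (fun f => f v = 0), filter_rootedColorings_eq_zero hS (by simp),
    filter_rootedColorings_ne_zero hN hS, add_comm]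
  congr 2
  refine rootedColorings_congr (fun w hw => ?_) k
  simp [Finset.ne_of_mem_erase hw]

theorem card_filter_rootedColorings_le {r : V} (hr : r ∈ S) {k : ℕ} (c c' : Fin (k + 1)) :
    ((rootedColorings G ∅ S k).filter fun f => f r = c).card ≤
      ((rootedColorings G ∅ S k).filter fun f => f r = c').card := by
  refine Finset.card_le_card_of_injOn (fun f v => if v ∈ S then Equiv.swap c c' (f v) else 0)
    (fun f hf => ?_) (fun f hf g hg hfg => ?_)
  · simp only [Finset.coe_filter, mem_rootedColorings, Set.mem_ofPred_eq] at hf ⊢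
    refine ⟨⟨fun v hv => by simp [hv], fun v hv w hw hvw => ?_, by simp⟩, by simp [hr, hf.2]⟩
    simpa [hv, hw] using hf.1.2.1 v hv w hw hvw
  · simp only [Finset.coe_filter, mem_rootedColorings, Set.mem_ofPred_eq] at hf hg
    funext v
    by_cases hv : v ∈ S
    · simpa [hv] using congrFun hfg v
    · rw [hf.1.1 v hv, hg.1.1 v hv]

theorem card_rootedColorings_of_disjoint {r : V} (hr : r ∈ S) (hN : Disjoint N S) (k : ℕ) :
    (rootedColorings G N S k).card =
      (k + 1) * (rootedColorings G (G.neighborSet r) (S.erase r) k).card := by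
  rw [rootedColorings_congr (N' := ∅) fun v hv => by simpa using Set.disjoint_right.1 hN hv,
    Finset.card_eq_sum_card_fiberwise (f := fun f => f r) (t := Finset.univ) (by simp),
    Finset.sum_const_nat fun c _ => le_antisymm (card_filter_rootedColorings_le hr c 0)
      (card_filter_rootedColorings_le hr 0 c),
    filter_rootedColorings_eq_zero hr (Set.notMem_empty r), Set.empty_union, Finset.card_univ,
    Fintype.card_fin]

theorem exists_rootedPolynomial (G : SimpleGraph V) (N : Set V) (S : Finset V) :
    ∃ P : ℤ[X], ∀ k : ℕ, P.eval ((k : ℤ) + 1) = (rootedColorings G N S k).card := by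
  induction N, S using rooted_induction G with
  | empty N => exact ⟨1, fun k => by simp [card_rootedColorings_empty]⟩
  | disjoint N S hS hN ih =>
    obtain ⟨r, hr⟩ := hS
    obtain ⟨P, hP⟩ := ih r hr
    exact ⟨X * P, fun k => by simp [hP, card_rootedColorings_of_disjoint hr hN]⟩
  | mem N S v hN hS ih_diff ih_erase =>
    obtain ⟨P, hP⟩ := ih_diff
    obtain ⟨P', hP'⟩ := ih_erase
    exact ⟨P - P', fun k => by simp [hP, hP', card_rootedColorings_diff_singleton hN hS]⟩

/-- The polynomial whose value at `k` is the number of proper `k`-colorings of `G[S]` avoiding one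
given color on `N`. -/
noncomputable def rootedPolynomial (G : SimpleGraph V) (N : Set V) (S : Finset V) : ℤ[X] :=
  (exists_rootedPolynomial G N S).choose

theorem rootedPolynomial_eval (G : SimpleGraph V) (N : Set V) (S : Finset V) (k : ℕ) :
    (rootedPolynomial G N S).eval ((k : ℤ) + 1) = (rootedColorings G N S k).card :=
  (exists_rootedPolynomial G N S).choose_spec k

theorem rootedPolynomial_congr (h : ∀ v ∈ S, v ∈ N ↔ v ∈ N') :
    rootedPolynomial G N S = rootedPolynomial G N' S :=
  eq_of_eval_add_one fun k => by simp only [rootedPolynomial_eval, rootedColorings_congr h]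

theorem rootedPolynomial_empty : rootedPolynomial G N ∅ = 1 :=
  eq_of_eval_add_one fun k => by simp [rootedPolynomial_eval, card_rootedColorings_empty]

theorem rootedPolynomial_of_disjoint {r : V} (hr : r ∈ S) (hN : Disjoint N S) :
    rootedPolynomial G N S = X * rootedPolynomial G (G.neighborSet r) (S.erase r) :=
  eq_of_eval_add_one fun k => by
    simp [rootedPolynomial_eval, card_rootedColorings_of_disjoint hr hN]

theorem rootedPolynomial_of_mem (hN : v ∈ N) (hS : v ∈ S) :
    rootedPolynomial G N S = rootedPolynomial G (N \ {v}) S -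
      rootedPolynomial G (N ∪ G.neighborSet v) (S.erase v) :=
  eq_of_eval_add_one fun k => by
    simp [rootedPolynomial_eval, card_rootedColorings_diff_singleton hN hS]

/-- The coefficients of `rootedPolynomial` without their alternating signs; they are nonnegative by
`rootedCoeff_nonneg`, and `rootedCoeff G ∅ S j` is the number `a j` of the graph `G[S]`. -/
noncomputable def rootedCoeff (G : SimpleGraph V) (N : Set V) (S : Finset V) (j : ℕ) : ℤ :=
  (-1) ^ (S.card + j) * (rootedPolynomial G N S).coeff j

theorem rootedCoeff_congr (h : ∀ v ∈ S, v ∈ N ↔ v ∈ N') (j : ℕ) :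
    rootedCoeff G N S j = rootedCoeff G N' S j := by
  rw [rootedCoeff, rootedCoeff, rootedPolynomial_congr h]

theorem rootedCoeff_eq_of_disjoint (hN : Disjoint N S) (j : ℕ) :
    rootedCoeff G N S j = rootedCoeff G ∅ S j :=
  rootedCoeff_congr (fun v hv => by simpa using Set.disjoint_right.1 hN hv) j

theorem rootedCoeff_empty (j : ℕ) : rootedCoeff G N ∅ j = if j = 0 then 1 else 0 := by
  rw [rootedCoeff, rootedPolynomial_empty, coeff_one]
  split_ifs with h <;> simp [h]

theorem rootedCoeff_zero_of_disjoint (hS : S.Nonempty) (hN : Disjoint N S) :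
    rootedCoeff G N S 0 = 0 := by
  obtain ⟨r, hr⟩ := hS
  rw [rootedCoeff, rootedPolynomial_of_disjoint hr hN, coeff_X_mul_zero, mul_zero]

theorem rootedCoeff_succ_of_disjoint {r : V} (hr : r ∈ S) (hN : Disjoint N S) (j : ℕ) :
    rootedCoeff G N S (j + 1) = rootedCoeff G (G.neighborSet r) (S.erase r) j := by
  rw [rootedCoeff, rootedCoeff, rootedPolynomial_of_disjoint hr hN, coeff_X_mul,
    ← Finset.card_erase_add_one hr]
  ring

theorem rootedCoeff_of_mem (hN : v ∈ N) (hS : v ∈ S) (j : ℕ) :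
    rootedCoeff G N S j = rootedCoeff G (N \ {v}) S j +
      rootedCoeff G (N ∪ G.neighborSet v) (S.erase v) j := by
  rw [rootedCoeff, rootedCoeff, rootedCoeff, rootedPolynomial_of_mem hN hS, coeff_sub,
    ← Finset.card_erase_add_one hS]
  ring

theorem rootedCoeff_nonneg (G : SimpleGraph V) (N : Set V) (S : Finset V) (j : ℕ) :
    0 ≤ rootedCoeff G N S j := by
  induction N, S using rooted_induction G generalizing j with
  | empty N =>
    rw [rootedCoeff_empty]
    positivity
  | disjoint N S hS hN ih =>
    cases j with
    | zero => rw [rootedCoeff_zero_of_disjoint hS hN]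
    | succ j =>
      obtain ⟨r, hr⟩ := hS
      rw [rootedCoeff_succ_of_disjoint hr hN]
      exact ih r hr j
  | mem N S v hN hS ih_diff ih_erase =>
    rw [rootedCoeff_of_mem hN hS]
    exact add_nonneg (ih_diff j) (ih_erase j)

theorem rootedCoeff_eq_sum_of_disjoint (hN : Disjoint N S) (j : ℕ) :
    rootedCoeff G N S j =
      ∑ T ∈ S.powerset, rootedCoeff G N T 0 * rootedCoeff G ∅ (S \ T) j := by
  rw [Finset.sum_eq_single ∅ (fun T hT hne => ?_) (by simp), rootedCoeff_empty, if_pos rfl, one_mul,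
    Finset.sdiff_empty, rootedCoeff_eq_of_disjoint hN]
  rw [rootedCoeff_zero_of_disjoint (Finset.nonempty_iff_ne_empty.2 hne)
    (hN.mono_right (Finset.coe_subset.2 (Finset.mem_powerset.1 hT))), zero_mul]

/-- `T` collects the components meeting `N` when a coefficient of `G[S]` is read as a count of
spanning forests, which is why only the constant coefficient of `rootedPolynomial G N T` enters. -/
theorem rootedCoeff_eq_sum (G : SimpleGraph V) (N : Set V) (S : Finset V) (j : ℕ) :
    rootedCoeff G N S j =
      ∑ T ∈ S.powerset, rootedCoeff G N T 0 * rootedCoeff G ∅ (S \ T) j := by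
  induction N, S using rooted_induction G with
  | empty N => exact rootedCoeff_eq_sum_of_disjoint (by simp) j
  | disjoint N S _ hN _ => exact rootedCoeff_eq_sum_of_disjoint hN j
  | mem N S v hN hS ih_diff ih_erase =>
    have hv : v ∉ S.erase v := Finset.notMem_erase v S
    rw [rootedCoeff_of_mem hN hS, ih_diff, ih_erase, ← Finset.insert_erase hS,
      Finset.sum_powerset_insert hv, Finset.sum_powerset_insert hv, Finset.erase_insert hv,
      add_assoc, ← Finset.sum_add_distrib]
    congr 1 <;> refine Finset.sum_congr rfl fun T hT => ?_
    all_goals have hvT : v ∉ T := fun h => hv (Finset.mem_powerset.1 hT h)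
    · rw [rootedCoeff_congr (N := N \ {v}) (N' := N)]
      exact fun w hw => by simp [ne_of_mem_of_not_mem hw hvT]
    · rw [rootedCoeff_of_mem hN (Finset.mem_insert_self v T), Finset.erase_insert hvT, add_mul,
        Finset.insert_sdiff_insert, Finset.sdiff_insert, Finset.erase_sdiff_comm,
        Finset.erase_idem]

theorem rootedCoeff_eq_zero_of_card_lt {j : ℕ} (h : S.card < j) : rootedCoeff G N S j = 0 := by
  induction N, S using rooted_induction G generalizing j with
  | empty N => rw [rootedCoeff_empty, if_neg (by simpa using h.ne')]
  | disjoint N S hS hN ih =>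
    obtain ⟨r, hr⟩ := hS
    obtain ⟨j, rfl⟩ := Nat.exists_eq_add_of_lt (Nat.zero_lt_of_lt h)
    rw [zero_add, rootedCoeff_succ_of_disjoint hr hN,
      ih r hr (by have := Finset.card_erase_add_one hr; lia)]
  | mem N S v hN hS ih_diff ih_erase =>
    rw [rootedCoeff_of_mem hN hS, ih_diff h,
      ih_erase ((Finset.card_erase_lt_of_mem hS).trans h), add_zero]

end RootedPolynomial

section ChromaticPolynomial

variable {V W : Type*} [Fintype V] [DecidableEq V] {G : SimpleGraph V}
  {H : SimpleGraph W} {S : Finset V}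

theorem card_coloring_eq_card_rootedColorings (e : H ↪g G) (hS : ↑S = Set.range e) (k : ℕ) :
    Nat.card (H.Coloring (Fin (k + 1))) = (rootedColorings G ∅ S k).card := by
  have mem_iff : ∀ v, v ∈ S ↔ ∃ w, e w = v := fun v => by rw [← Finset.mem_coe, hS, Set.mem_range]
  rw [← Nat.card_eq_finsetCard]
  refine Nat.card_congr
    { toFun := fun C => ⟨Function.extend e C 0, mem_rootedColorings.2
        ⟨fun v hv => Function.extend_apply' _ _ _ (mt (mem_iff v).2 hv), ?_, by simp⟩⟩
      invFun := fun f => SimpleGraph.Coloring.mk (fun w => f.1 (e w)) fun {x y} hxy =>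
        (mem_rootedColorings.1 f.2).2.1 _ ((mem_iff _).2 ⟨x, rfl⟩) _ ((mem_iff _).2 ⟨y, rfl⟩)
          (e.map_adj_iff.2 hxy)
      left_inv := fun C => RelHom.ext fun w => e.injective.extend_apply _ _ w
      right_inv := fun f => Subtype.ext (funext fun v => ?_) }
  · intro v hv w hw hvw
    obtain ⟨x, rfl⟩ := (mem_iff v).1 hv
    obtain ⟨y, rfl⟩ := (mem_iff w).1 hw
    rw [e.injective.extend_apply, e.injective.extend_apply]
    exact C.valid (e.map_adj_iff.1 hvw)
  · by_cases hv : v ∈ S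
    · obtain ⟨x, rfl⟩ := (mem_iff v).1 hv
      exact e.injective.extend_apply _ _ x
    · rw [(mem_rootedColorings.1 f.2).1 v hv]
      exact Function.extend_apply' _ _ _ (mt (mem_iff v).2 hv)

theorem chromaticPolynomial_eq_rootedPolynomial [Finite W] (e : H ↪g G) (hS : ↑S = Set.range e) :
    chromaticPolynomial H = rootedPolynomial G ∅ S := by
  refine eq_of_eval_add_one fun k => ?_
  rw [rootedPolynomial_eval, ← card_coloring_eq_card_rootedColorings e hS,
    ← chromaticPolynomial_eval H (k + 1) k.succ_pos, Nat.cast_succ]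

theorem a_eq_rootedCoeff_of_embedding [Finite W] (e : H ↪g G) (hS : ↑S = Set.range e) (i : ℕ) :
    a H i = rootedCoeff G ∅ S i := by
  have hcard : Nat.card W = S.card := by
    rw [← Set.ncard_coe_finset, hS, ← Set.image_univ, Set.ncard_image_of_injective _ e.injective,
      Set.ncard_univ]
  rw [a, chromaticPolynomial_eq_rootedPolynomial e hS, hcard]
  rcases le_or_gt i S.card with hi | hi
  · have hparity : Even (S.card - i) ↔ Even (S.card + i) := by rw [Nat.even_sub hi, Nat.even_add]
    rw [rootedCoeff, neg_one_pow_congr hparity]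
  · have hzero : rootedCoeff G ∅ S i = 0 := rootedCoeff_eq_zero_of_card_lt hi
    have hcoeff : (rootedPolynomial G ∅ S).coeff i = 0 :=
      (mul_eq_zero.1 hzero).resolve_left (pow_ne_zero _ (by norm_num))
    rw [hzero, hcoeff, mul_zero]

theorem a_eq_rootedCoeff (G : SimpleGraph V) (i : ℕ) : a G i = rootedCoeff G ∅ Finset.univ i :=
  a_eq_rootedCoeff_of_embedding SimpleGraph.Embedding.refl (by
    rw [Finset.coe_univ]
    exact Set.range_id.symm) i

theorem a_deleteVertex_eq_rootedCoeff (G : SimpleGraph V) (u : V) (i : ℕ) :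
    a (deleteVertex G u) i = rootedCoeff G ∅ {u}ᶜ i :=
  a_eq_rootedCoeff_of_embedding (SimpleGraph.Embedding.induce _) (by
    rw [Finset.coe_compl, Finset.coe_singleton]
    exact Subtype.range_coe.symm) i

end ChromaticPolynomial

section LinearDefect

theorem erase_sdiff_erase_of_mem {α : Type*} [DecidableEq α] {S T : Finset α} {r : α}
    (hr : r ∈ T) : S.erase r \ T.erase r = S \ T := by
  ext v
  grind

theorem sum_sum_powerset_erase {α M : Type*} [DecidableEq α] [AddCommMonoid M] (S : Finset α)
    (g : α → Finset α → M) :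
    ∑ r ∈ S, ∑ T ∈ (S.erase r).powerset, g r T = ∑ T ∈ S.powerset, ∑ r ∈ T, g r (T.erase r) := by
  rw [Finset.sum_sigma', Finset.sum_sigma']
  refine Finset.sum_bij' (fun p _ => ⟨insert p.1 p.2, p.1⟩) (fun p _ => ⟨p.2, p.1.erase p.2⟩)
    ?_ ?_ ?_ ?_ ?_
  all_goals rintro ⟨x, y⟩ h
  all_goals simp only [Finset.mem_sigma, Finset.mem_powerset] at h ⊢
  · exact ⟨Finset.insert_subset h.1 (h.2.trans (Finset.erase_subset _ _)),
      Finset.mem_insert_self _ _⟩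
  · exact ⟨h.1 h.2, Finset.erase_subset_erase _ h.1⟩
  · rw [Finset.erase_insert fun hx => Finset.notMem_erase x S (h.2 hx)]
  · rw [Finset.insert_erase h.2]
  · rw [Finset.erase_insert fun hx => Finset.notMem_erase x S (h.2 hx)]

variable {V : Type*} [Fintype V] [DecidableEq V]

/-- The linear coefficients of `G[T]`, one for each choice of the root `r`, summed up. They all
agree, so that this is `|T|` times the number `a 1` of the graph `G[T]`. -/
noncomputable def rootWeight (G : SimpleGraph V) (T : Finset V) : ℤ :=
  ∑ r ∈ T, rootedCoeff G (G.neighborSet r) (T.erase r) 0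

/-- The amount by which the constant coefficients of the graphs `G[S] - u`, rooted at `N`, exceed
that of `G[S]` in total. -/
noncomputable def excess (G : SimpleGraph V) (N : Set V) (S : Finset V) : ℤ :=
  ∑ u ∈ S, rootedCoeff G N (S.erase u) 0 - rootedCoeff G N S 0

/-- The value `d 1` of the graph `G[T]`. -/
noncomputable def linearDefect (G : SimpleGraph V) (T : Finset V) : ℤ :=
  ∑ u ∈ T, rootWeight G (T.erase u) + (if T.card = 1 then 1 else 0) - rootWeight G T

variable {G : SimpleGraph V} {N : Set V} {S T : Finset V} {v : V}

theorem card_mul_rootedCoeff (G : SimpleGraph V) (S : Finset V) (i : ℕ) :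
    (S.card : ℤ) * rootedCoeff G ∅ S (i + 1) =
      ∑ T ∈ S.powerset, rootWeight G T * rootedCoeff G ∅ (S \ T) i := by
  calc (S.card : ℤ) * rootedCoeff G ∅ S (i + 1)
      = ∑ r ∈ S, rootedCoeff G ∅ S (i + 1) := by rw [Finset.sum_const, nsmul_eq_mul]
    _ = ∑ r ∈ S, ∑ T ∈ (S.erase r).powerset,
          rootedCoeff G (G.neighborSet r) T 0 * rootedCoeff G ∅ (S.erase r \ T) i :=
        Finset.sum_congr rfl fun r hr => by
          rw [rootedCoeff_succ_of_disjoint hr (Set.empty_disjoint _), rootedCoeff_eq_sum]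
    _ = ∑ T ∈ S.powerset, ∑ r ∈ T,
          rootedCoeff G (G.neighborSet r) (T.erase r) 0 * rootedCoeff G ∅ (S \ T) i := by
        rw [sum_sum_powerset_erase]
        refine Finset.sum_congr rfl fun T _ => Finset.sum_congr rfl fun r hr => ?_
        rw [erase_sdiff_erase_of_mem hr]
    _ = _ := by simp only [rootWeight, Finset.sum_mul]

theorem sum_rootedCoeff_compl_singleton (G : SimpleGraph V) (i : ℕ) :
    ∑ u : V, rootedCoeff G ∅ {u}ᶜ i =
      ∑ T : Finset V, (if T.card = 1 then 1 else 0) * rootedCoeff G ∅ Tᶜ i := by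
  simp only [ite_mul, one_mul, zero_mul]
  rw [← Finset.sum_filter, Finset.univ_filter_card_eq, Finset.powersetCard_one, Finset.sum_map]
  rfl

theorem sum_mul_rootedCoeff_compl_singleton (G : SimpleGraph V) (i : ℕ) :
    ∑ u : V, ((Nat.card V : ℤ) - 1) * rootedCoeff G ∅ {u}ᶜ (i + 1) =
      ∑ T : Finset V, (∑ u ∈ T, rootWeight G (T.erase u)) * rootedCoeff G ∅ Tᶜ i := by
  have hcard : ∀ u : V, ((Nat.card V : ℤ) - 1) = ((Finset.univ.erase u).card : ℤ) := fun u => by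
    rw [Nat.card_eq_fintype_card, ← Finset.card_univ,
      ← Finset.card_erase_add_one (Finset.mem_univ u)]
    simp
  calc ∑ u : V, ((Nat.card V : ℤ) - 1) * rootedCoeff G ∅ {u}ᶜ (i + 1)
      = ∑ u : V, ∑ T ∈ (Finset.univ.erase u).powerset,
          rootWeight G T * rootedCoeff G ∅ (Finset.univ.erase u \ T) i :=
        Finset.sum_congr rfl fun u _ => by
          rw [hcard u, Finset.compl_singleton, card_mul_rootedCoeff]
    _ = ∑ T : Finset V, ∑ u ∈ T, rootWeight G (T.erase u) * rootedCoeff G ∅ Tᶜ i := by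
        rw [sum_sum_powerset_erase, Finset.powerset_univ]
        refine Finset.sum_congr rfl fun T _ => Finset.sum_congr rfl fun u hu => ?_
        rw [erase_sdiff_erase_of_mem hu, Finset.compl_eq_univ_sdiff]
    _ = _ := by simp only [Finset.sum_mul]

theorem d_eq_sum (G : SimpleGraph V) (i : ℕ) :
    d G (i + 1) = ∑ T : Finset V, linearDefect G T * rootedCoeff G ∅ Tᶜ i := by
  have htotal : (Nat.card V : ℤ) * rootedCoeff G ∅ Finset.univ (i + 1) =
      ∑ T : Finset V, rootWeight G T * rootedCoeff G ∅ Tᶜ i := by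
    simp only [Nat.card_eq_fintype_card, ← Finset.card_univ, card_mul_rootedCoeff,
      Finset.powerset_univ, Finset.compl_eq_univ_sdiff]
  simp only [d, a_deleteVertex_eq_rootedCoeff, Nat.add_sub_cancel]
  rw [a_eq_rootedCoeff, Finset.sum_add_distrib, sum_rootedCoeff_compl_singleton,
    sum_mul_rootedCoeff_compl_singleton, htotal, ← Finset.sum_add_distrib,
    ← Finset.sum_sub_distrib]
  refine Finset.sum_congr rfl fun T _ => ?_
  rw [linearDefect]
  ring

theorem linearDefect_eq_zero_of_card_le_one (hT : T.card ≤ 1) : linearDefect G T = 0 := by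
  rcases Nat.le_one_iff_eq_zero_or_eq_one.1 hT with hT | hT
  · obtain rfl := Finset.card_eq_zero.1 hT
    simp [linearDefect, rootWeight]
  · obtain ⟨x, rfl⟩ := Finset.card_eq_one.1 hT
    simp [linearDefect, rootWeight, rootedCoeff_empty]

theorem linearDefect_eq_sum (hT : 1 < T.card) :
    linearDefect G T = ∑ r ∈ T, excess G (G.neighborSet r) (T.erase r) := by
  simp only [linearDefect, if_neg hT.ne', add_zero, rootWeight, excess, Finset.sum_sub_distrib]
  congr 1
  rw [Finset.sum_comm' (s' := fun r => T.erase r) (t' := T) fun u r => by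
    simp only [Finset.mem_erase]
    tauto]
  simp only [Finset.erase_right_comm]

theorem excess_of_mem (hN : v ∈ N) (hS : v ∈ S) :
    excess G N S = excess G (N \ {v}) S + excess G (N ∪ G.neighborSet v) (S.erase v) := by
  have hcongr : rootedCoeff G N (S.erase v) 0 = rootedCoeff G (N \ {v}) (S.erase v) 0 :=
    rootedCoeff_congr (fun w hw => by simp [Finset.ne_of_mem_erase hw]) 0
  have hmem : ∀ u ∈ S.erase v, rootedCoeff G N (S.erase u) 0 =
      rootedCoeff G (N \ {v}) (S.erase u) 0 +
        rootedCoeff G (N ∪ G.neighborSet v) ((S.erase v).erase u) 0 := fun u hu => by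
    rw [rootedCoeff_of_mem hN (Finset.mem_erase.2 ⟨(Finset.ne_of_mem_erase hu).symm, hS⟩),
      Finset.erase_right_comm]
  rw [excess, excess, excess, rootedCoeff_of_mem hN hS, ← Finset.add_sum_erase S _ hS,
    ← Finset.add_sum_erase S (fun u => rootedCoeff G (N \ {v}) (S.erase u) 0) hS, hcongr,
    Finset.sum_congr rfl hmem, Finset.sum_add_distrib]
  ring

theorem excess_singleton_of_notMem {u : V} (hu : u ∉ N) : excess G N {u} = 1 := by
  rw [excess, rootedCoeff_zero_of_disjoint (Finset.singleton_nonempty u) (by simpa using hu)]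
  simp [rootedCoeff_empty]

theorem excess_singleton_of_mem {u : V} (hu : u ∈ N) : excess G N {u} = 0 := by
  rw [excess_of_mem hu (Finset.mem_singleton_self u), excess_singleton_of_notMem (by simp)]
  simp [excess, rootedCoeff_empty]

theorem excess_of_disjoint (hN : Disjoint N S) (hS : 1 < S.card) : excess G N S = 0 := by
  rw [excess, rootedCoeff_zero_of_disjoint (Finset.card_pos.1 (by lia)) hN, sub_zero]
  refine Finset.sum_eq_zero fun u hu => rootedCoeff_zero_of_disjoint (Finset.card_pos.1 ?_)
    (hN.mono_right (Finset.coe_subset.2 (Finset.erase_subset _ _)))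
  rw [Finset.card_erase_of_mem hu]
  lia

theorem excess_nonneg (hS : S.Nonempty) : 0 ≤ excess G N S := by
  induction N, S using rooted_induction G with
  | empty N => exact absurd hS Finset.not_nonempty_empty
  | disjoint N S _ hN _ =>
    rw [excess, rootedCoeff_zero_of_disjoint hS hN, sub_zero]
    exact Finset.sum_nonneg fun u _ => rootedCoeff_nonneg G _ _ _
  | mem N S v hN hv ih_diff ih_erase =>
    rcases (S.erase v).eq_empty_or_nonempty with hempty | hne
    · obtain rfl : S = {v} := by rw [← Finset.insert_erase hv, hempty, insert_empty_eq]
      rw [excess_singleton_of_mem hN]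
    · rw [excess_of_mem hN hv]
      exact add_nonneg (ih_diff hS) (ih_erase hne)

theorem linearDefect_nonneg (G : SimpleGraph V) (T : Finset V) : 0 ≤ linearDefect G T := by
  rcases le_or_gt T.card 1 with hT | hT
  · rw [linearDefect_eq_zero_of_card_le_one hT]
  · rw [linearDefect_eq_sum hT]
    refine Finset.sum_nonneg fun r hr => excess_nonneg (Finset.card_pos.1 ?_)
    rw [Finset.card_erase_of_mem hr]
    lia

theorem d_eq_zero_iff (G : SimpleGraph V) (i : ℕ) :
    d G (i + 1) = 0 ↔ ∀ T : Finset V, linearDefect G T = 0 ∨ rootedCoeff G ∅ Tᶜ i = 0 := by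
  rw [d_eq_sum, Finset.sum_eq_zero_iff_of_nonneg fun T _ =>
    mul_nonneg (linearDefect_nonneg G T) (rootedCoeff_nonneg G _ _ _)]
  simp only [Finset.mem_univ, true_imp_iff, mul_eq_zero]

end LinearDefect

theorem d_nonneg {V : Type*} [Fintype V] (G : SimpleGraph V) (i : ℕ) : 0 ≤ d G (i + 1) := by
  classical
  rw [d_eq_sum]
  exact Finset.sum_nonneg fun T _ =>
    mul_nonneg (linearDefect_nonneg G T) (rootedCoeff_nonneg G _ _ _)

section Anchored

/-- Every connected component of `G[S]` meets `N`, expressed through cuts: every nonempty `U ⊆ S`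
meets `N` or is joined to `S \ U`. In particular `Anchored G {r} S` with `r ∈ S` says that `G[S]` is
connected. -/
def Anchored {V : Type*} (G : SimpleGraph V) (N : Set V) (S : Finset V) : Prop :=
  ∀ U ⊆ S, U.Nonempty → ∃ u ∈ U, u ∈ N ∨ ∃ w ∈ S, w ∉ U ∧ G.Adj u w

variable {V : Type*} {G : SimpleGraph V} {N N' : Set V} {S S' : Finset V}

theorem anchored_empty (G : SimpleGraph V) (N : Set V) : Anchored G N ∅ := fun U hU hne => by
  rw [Finset.subset_empty.1 hU] at hne
  exact absurd hne Finset.not_nonempty_empty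

theorem anchored_of_subset (h : ↑S ⊆ N) : Anchored G N S :=
  fun _ hU ⟨u, hu⟩ => ⟨u, hu, Or.inl (h (hU hu))⟩

theorem Anchored.exists_mem (h : Anchored G N S) (hS : S.Nonempty) : ∃ v ∈ S, v ∈ N := by
  obtain ⟨v, hv, hN | ⟨w, hw, hwS, -⟩⟩ := h S subset_rfl hS
  · exact ⟨v, hv, hN⟩
  · exact absurd hw hwS

theorem Anchored.mono (h : Anchored G N S) (hN : ∀ v ∈ S, v ∈ N → v ∈ N') : Anchored G N' S := by
  intro U hU hne
  obtain ⟨u, hu, h⟩ := h U hU hne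
  exact ⟨u, hu, h.imp_left (hN u (hU hu))⟩

theorem Anchored.exists_adj {v : V} (h : Anchored G N S) (hv : v ∈ S) (hvN : v ∉ N) :
    ∃ w ∈ S, G.Adj v w := by
  obtain ⟨u, hu, huN | ⟨w, hw, -, huw⟩⟩ :=
    h {v} (Finset.singleton_subset_iff.2 hv) (Finset.singleton_nonempty v)
  all_goals obtain rfl := Finset.mem_singleton.1 hu
  · exact absurd huN hvN
  · exact ⟨w, hw, huw⟩

theorem Anchored.subset (h : Anchored G N S) (hS' : S' ⊆ S)
    (hclosed : ∀ u ∈ S', ∀ w ∈ S, G.Adj u w → w ∈ S') : Anchored G N S' := by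
  intro U hU hne
  obtain ⟨u, hu, h⟩ := h U (hU.trans hS') hne
  refine ⟨u, hu, h.imp_right ?_⟩
  rintro ⟨w, hw, hwU, huw⟩
  exact ⟨w, hclosed u (hU hu) w hw huw, hwU, huw⟩

variable [DecidableEq V]

theorem Anchored.union (h : Anchored G N S) (h' : Anchored G N' S') :
    Anchored G (N ∪ N') (S ∪ S') := by
  have anchored_inter : ∀ {M : Set V} {T : Finset V}, Anchored G M T → M ⊆ N ∪ N' → T ⊆ S ∪ S' →
      ∀ U : Finset V, ∀ x ∈ U, x ∈ T →
        ∃ u ∈ U, u ∈ N ∪ N' ∨ ∃ w ∈ S ∪ S', w ∉ U ∧ G.Adj u w := by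
    intro M T hMT hM hT U x hx hxT
    obtain ⟨u, hu, h⟩ := hMT (U ∩ T) Finset.inter_subset_right ⟨x, Finset.mem_inter.2 ⟨hx, hxT⟩⟩
    refine ⟨u, (Finset.mem_inter.1 hu).1, h.imp (fun h => hM h) ?_⟩
    rintro ⟨w, hw, hwU, hadj⟩
    exact ⟨w, hT hw, fun h => hwU (Finset.mem_inter.2 ⟨h, hw⟩), hadj⟩
  rintro U hU ⟨x, hx⟩
  rcases Finset.mem_union.1 (hU hx) with hxS | hxS
  · exact anchored_inter h Set.subset_union_left Finset.subset_union_left U x hx hxS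
  · exact anchored_inter h' Set.subset_union_right Finset.subset_union_right U x hx hxS

theorem Anchored.insert_of_mem {x : V} (h : Anchored G N S) (hx : x ∈ N) :
    Anchored G N (insert x S) := by
  rw [Finset.insert_eq, ← Set.union_self N]
  exact (anchored_of_subset (by simpa using hx)).union h

theorem Anchored.insert_of_adj {x s : V} (h : Anchored G N S) (hs : s ∈ S) (hxs : G.Adj x s) :
    Anchored G N (insert x S) := by
  intro U hU ⟨u, hu⟩
  rcases (U ∩ S).eq_empty_or_nonempty with hUS | hUS
  · have hdisj : ∀ w ∈ U, w ∉ S := fun w hwU hwS =>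
      Finset.notMem_empty w (hUS ▸ Finset.mem_inter.2 ⟨hwU, hwS⟩)
    obtain rfl : u = x := (Finset.mem_insert.1 (hU hu)).resolve_right (hdisj u hu)
    exact ⟨u, hu, Or.inr ⟨s, Finset.mem_insert_of_mem hs, fun h => hdisj s h hs, hxs⟩⟩
  · obtain ⟨u, hu, h⟩ := h (U ∩ S) Finset.inter_subset_right hUS
    refine ⟨u, (Finset.mem_inter.1 hu).1, h.imp_right ?_⟩
    rintro ⟨w, hw, hwU, hadj⟩
    exact ⟨w, Finset.mem_insert_of_mem hw, fun h => hwU (Finset.mem_inter.2 ⟨h, hw⟩), hadj⟩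

theorem Anchored.exists_insert {W : Finset V} (hS : Anchored G N S) (hW : Anchored G N W)
    (hWS : W ⊂ S) : ∃ x ∈ S \ W, Anchored G N (insert x W) := by
  obtain ⟨x, hx, hN | ⟨w, hwS, hw, hxw⟩⟩ :=
    hS (S \ W) Finset.sdiff_subset (Finset.sdiff_nonempty.2 hWS.not_subset)
  · exact ⟨x, hx, hW.insert_of_mem hN⟩
  · have hwW : w ∈ W := by_contra fun h => hw (Finset.mem_sdiff.2 ⟨hwS, h⟩)
    exact ⟨x, hx, hW.insert_of_adj hwW hxw⟩

theorem Anchored.exists_erase {W : Finset V} (hS : Anchored G N S) (hW : Anchored G N W)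
    (hWS : W ⊂ S) : ∃ x ∈ S \ W, Anchored G N (S.erase x) := by
  induction hc : (S \ W).card generalizing W with
  | zero =>
    exact absurd (Finset.sdiff_eq_empty_iff_subset.1 (Finset.card_eq_zero.1 hc)) hWS.not_subset
  | succ m ih =>
    obtain ⟨u, hu, hins⟩ := hS.exists_insert hW hWS
    have hu' := Finset.mem_sdiff.1 hu
    rcases (Finset.insert_subset hu'.1 hWS.subset).eq_or_ssubset with heq | hss
    · exact ⟨u, hu, by rwa [← heq, Finset.erase_insert hu'.2]⟩
    · obtain ⟨x, hx, h⟩ := ih hins hss (by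
        rw [Finset.sdiff_insert, Finset.card_erase_of_mem hu, hc, Nat.add_sub_cancel])
      exact ⟨x, Finset.sdiff_subset_sdiff subset_rfl (Finset.subset_insert _ _) hx, h⟩

theorem Anchored.erase_of_subsingleton {x : V} (h : Anchored G N S) (hx : x ∈ S) (hxN : x ∉ N)
    (hleaf : (G.neighborSet x ∩ S).Subsingleton) : Anchored G N (S.erase x) := by
  intro U hU hne
  have hxU : x ∉ U := fun hxU => Finset.notMem_erase x S (hU hxU)
  obtain ⟨u, hu, hN | ⟨w, hwS, hwU, huw⟩⟩ := h U (hU.trans (Finset.erase_subset _ _)) hne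
  · exact ⟨u, hu, Or.inl hN⟩
  rcases eq_or_ne w x with rfl | hwx
  · have hins : insert w U ⊆ S := Finset.insert_subset hx (hU.trans (Finset.erase_subset _ _))
    obtain ⟨u', hu', h'⟩ := h (insert w U) hins (Finset.insert_nonempty w U)
    rcases Finset.mem_insert.1 hu' with rfl | hu'U
    · obtain ⟨w', hw'S, hw'U, hadj⟩ := h'.resolve_left hxN
      obtain rfl := hleaf ⟨hadj, hw'S⟩ ⟨huw.symm, hins (Finset.mem_insert_of_mem hu)⟩
      exact absurd (Finset.mem_insert_of_mem hu) hw'U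
    · refine ⟨u', hu'U, h'.imp_right ?_⟩
      rintro ⟨w', hw'S, hw'U, hadj⟩
      rw [Finset.mem_insert, not_or] at hw'U
      exact ⟨w', Finset.mem_erase.2 ⟨hw'U.1, hw'S⟩, hw'U.2, hadj⟩
  · exact ⟨u, hu, Or.inr ⟨w, Finset.mem_erase.2 ⟨hwx, hwS⟩, hwU, huw⟩⟩

theorem anchored_iff_of_mem {v : V} (hN : v ∈ N) (hS : v ∈ S) :
    Anchored G N S ↔ Anchored G (N ∪ G.neighborSet v) (S.erase v) := by
  constructor
  · intro h U hU hne
    obtain ⟨u, hu, huN | ⟨w, hw, hwU, huw⟩⟩ := h U (hU.trans (Finset.erase_subset _ _)) hne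
    · exact ⟨u, hu, Or.inl (Or.inl huN)⟩
    rcases eq_or_ne w v with rfl | hwv
    · exact ⟨u, hu, Or.inl (Or.inr huw.symm)⟩
    · exact ⟨u, hu, Or.inr ⟨w, Finset.mem_erase.2 ⟨hwv, hw⟩, hwU, huw⟩⟩
  · intro h U hU hne
    by_cases hv : v ∈ U
    · exact ⟨v, hv, Or.inl hN⟩
    obtain ⟨u, hu, (huN | hvu) | ⟨w, hw, hwU, huw⟩⟩ := h U (Finset.subset_erase.2 ⟨hU, hv⟩) hne
    · exact ⟨u, hu, Or.inl huN⟩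
    · exact ⟨u, hu, Or.inr ⟨v, hS, hv, hvu.symm⟩⟩
    · exact ⟨u, hu, Or.inr ⟨w, Finset.mem_of_mem_erase hw, hwU, huw⟩⟩

theorem anchored_singleton_iff {r : V} (hr : r ∈ S) :
    Anchored G {r} S ↔ Anchored G (G.neighborSet r) (S.erase r) := by
  rw [anchored_iff_of_mem (Set.mem_singleton r) hr]
  refine ⟨fun h => h.mono fun v hv => ?_, fun h => h.mono fun v _ => Or.inr⟩
  simp [Finset.ne_of_mem_erase hv]

variable [Fintype V]

theorem exists_anchored_of_rootedCoeff_ne_zero {j : ℕ} (h : rootedCoeff G N S j ≠ 0) :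
    ∃ M ⊆ S, M.card = j ∧ Anchored G (N ∪ M) S := by
  induction N, S using rooted_induction G generalizing j with
  | empty N =>
    rw [rootedCoeff_empty] at h
    exact ⟨∅, subset_rfl, by simpa [eq_comm] using h, anchored_empty G _⟩
  | disjoint N S hS hN ih =>
    cases j with
    | zero => exact absurd (rootedCoeff_zero_of_disjoint hS hN) h
    | succ j =>
      obtain ⟨r, hr⟩ := hS
      rw [rootedCoeff_succ_of_disjoint hr hN] at h
      obtain ⟨M, hMS, hM, hanc⟩ := ih r hr h
      refine ⟨insert r M, Finset.insert_subset hr (hMS.trans (Finset.erase_subset _ _)), ?_, ?_⟩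
      · rw [Finset.card_insert_of_notMem fun h => Finset.notMem_erase r S (hMS h), hM]
      · rw [anchored_iff_of_mem (v := r) (by simp) hr]
        exact hanc.mono fun v _ hv => by grind
  | mem N S v hN hS ih_diff ih_erase =>
    by_cases hdiff : rootedCoeff G (N \ {v}) S j = 0
    · rw [rootedCoeff_of_mem hN hS, hdiff, zero_add] at h
      obtain ⟨M, hMS, hM, hanc⟩ := ih_erase h
      refine ⟨M, hMS.trans (Finset.erase_subset _ _), hM, ?_⟩
      rwa [anchored_iff_of_mem (Set.mem_union_left _ hN) hS, Set.union_right_comm]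
    · obtain ⟨M, hMS, hM, hanc⟩ := ih_diff hdiff
      exact ⟨M, hMS, hM, hanc.mono fun w _ => Or.imp_left And.left⟩

theorem rootedCoeff_card_pos {M : Finset V} (hM : M ⊆ S) (h : Anchored G (N ∪ M) S) :
    0 < rootedCoeff G N S M.card := by
  induction N, S using rooted_induction G generalizing M with
  | empty N => simp [rootedCoeff_empty, Finset.subset_empty.1 hM]
  | disjoint N S hS hN ih =>
    obtain ⟨r, hr, hrNM⟩ := h.exists_mem hS
    have hrM : r ∈ M := hrNM.resolve_left (Set.disjoint_right.1 hN hr)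
    rw [← Finset.card_erase_add_one hrM, rootedCoeff_succ_of_disjoint hr hN]
    refine ih r hr (Finset.erase_subset_erase _ hM) ?_
    refine ((anchored_iff_of_mem hrNM hr).1 h).mono fun w hw hwN => ?_
    have : w ∉ N := Set.disjoint_right.1 hN (Finset.mem_of_mem_erase hw)
    grind
  | mem N S v hN hS ih_diff ih_erase =>
    rw [rootedCoeff_of_mem hN hS]
    by_cases hv : v ∈ M
    · refine add_pos_of_pos_of_nonneg (ih_diff hM (h.mono fun w _ hw => ?_))
        (rootedCoeff_nonneg G _ _ _)
      grind
    · refine add_pos_of_nonneg_of_pos (rootedCoeff_nonneg G _ _ _)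
        (ih_erase (Finset.subset_erase.2 ⟨hM, hv⟩) ?_)
      rwa [Set.union_right_comm, ← anchored_iff_of_mem (Set.mem_union_left _ hN) hS]

theorem rootedCoeff_pos_of_ncard_le {j : ℕ} (h : Anchored G N S) (hN : N.ncard ≤ j)
    (hj : j ≤ S.card) : 0 < rootedCoeff G ∅ S j := by
  lift N to Finset V using N.toFinite
  rw [Set.ncard_coe_finset] at hN
  obtain ⟨M, hNM, hMS, rfl⟩ := Finset.exists_subsuperset_card_eq (s := N ∩ S)
    Finset.inter_subset_right ((Finset.card_le_card Finset.inter_subset_left).trans hN) hj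
  exact rootedCoeff_card_pos hMS (h.mono fun v hv hvN =>
    Set.mem_union_right _ (hNM (Finset.mem_inter.2 ⟨hvN, hv⟩)))

end Anchored

section Positivity

variable {V : Type*} [Fintype V] [DecidableEq V] {G : SimpleGraph V} {N : Set V}
  {S C X T : Finset V}

theorem excess_le_excess_union (hX : X.Nonempty) (hSX : Disjoint S X) (h : Anchored G N S) :
    excess G (N ∪ ⋃ w ∈ S, G.neighborSet w) X ≤ excess G N (S ∪ X) := by
  induction hc : S.card generalizing S N with
  | zero => simp [Finset.card_eq_zero.1 hc]
  | succ m ih =>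
    obtain ⟨v, hv, hvN⟩ := h.exists_mem (Finset.card_pos.1 (by lia))
    have hvX : v ∉ X := Finset.disjoint_left.1 hSX hv
    have hbranch := ih (hSX.mono_left (Finset.erase_subset _ _)) ((anchored_iff_of_mem hvN hv).1 h)
      (by rw [Finset.card_erase_of_mem hv, hc, Nat.add_sub_cancel])
    rw [Set.union_assoc, ← Finset.set_biUnion_insert, Finset.insert_erase hv] at hbranch
    rw [excess_of_mem hvN (Finset.mem_union_left _ hv), Finset.erase_union_distrib,
      Finset.erase_eq_of_notMem hvX]
    exact le_add_of_nonneg_of_le (excess_nonneg (hX.mono Finset.subset_union_right)) hbranch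

theorem excess_le_linearDefect_union {r : V} (hr : r ∈ C) (hC : Anchored G {r} C)
    (hX : X.Nonempty) (hCX : Disjoint C X) :
    excess G (⋃ w ∈ C, G.neighborSet w) X ≤ linearDefect G (C ∪ X) := by
  have hcard : 1 < (C ∪ X).card := by
    rw [Finset.card_union_of_disjoint hCX]
    exact Nat.add_lt_add_of_le_of_lt (Finset.card_pos.2 ⟨r, hr⟩) (Finset.card_pos.2 hX)
  have hnonneg : ∀ s ∈ C ∪ X, 0 ≤ excess G (G.neighborSet s) ((C ∪ X).erase s) := fun s hs =>
    excess_nonneg (Finset.card_pos.1 (by rw [Finset.card_erase_of_mem hs]; lia))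
  calc excess G (⋃ w ∈ C, G.neighborSet w) X
      = excess G (G.neighborSet r ∪ ⋃ w ∈ C.erase r, G.neighborSet w) X := by
        rw [← Finset.set_biUnion_insert, Finset.insert_erase hr]
    _ ≤ excess G (G.neighborSet r) (C.erase r ∪ X) :=
        excess_le_excess_union hX (hCX.mono_left (Finset.erase_subset _ _))
          ((anchored_singleton_iff hr).1 hC)
    _ = excess G (G.neighborSet r) ((C ∪ X).erase r) := by
        rw [Finset.erase_union_distrib, Finset.erase_eq_of_notMem (Finset.disjoint_left.1 hCX hr)]
    _ ≤ linearDefect G (C ∪ X) := by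
        rw [linearDefect_eq_sum hcard]
        exact Finset.single_le_sum hnonneg (Finset.mem_union_left X hr)

theorem linearDefect_insert_pos {r x : V} (hr : r ∈ C) (hC : Anchored G {r} C)
    (hx : x ∉ C) (hxC : ∀ w ∈ C, ¬G.Adj w x) : 0 < linearDefect G (insert x C) := by
  rw [Finset.insert_eq, Finset.union_comm]
  refine lt_of_lt_of_le ?_ (excess_le_linearDefect_union hr hC (Finset.singleton_nonempty x)
    (Finset.disjoint_singleton_right.2 hx))
  rw [excess_singleton_of_notMem (by simpa using hxC)]
  exact one_pos

theorem excess_pair {x y : V} (hxN : x ∈ N) (hyN : y ∈ N) (hxy : x ≠ y) (hadj : ¬G.Adj x y) :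
    excess G N {x, y} = 1 := by
  have hyx : ¬G.Adj y x := fun h => hadj h.symm
  have hyNx : y ∈ N \ {x} := ⟨hyN, hxy.symm⟩
  rw [excess_of_mem hxN (Finset.mem_insert_self x {y}), excess_of_mem hyNx (by simp),
    Finset.erase_insert (by simpa using hxy), Finset.pair_comm,
    Finset.erase_insert (by simpa using hxy.symm),
    excess_of_disjoint (by simp) (by rw [Finset.card_pair hxy.symm]; lia),
    excess_singleton_of_notMem (by simp [hyx]), excess_singleton_of_mem (Set.mem_union_left _ hyN)]
  norm_num

theorem linearDefect_union_pair_pos {r x y s t : V} (hr : r ∈ C) (hC : Anchored G {r} C)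
    (hx : x ∉ C) (hy : y ∉ C) (hxy : x ≠ y) (hadj : ¬G.Adj x y) (hs : s ∈ C) (hsx : G.Adj s x)
    (ht : t ∈ C) (hty : G.Adj t y) : 0 < linearDefect G (C ∪ {x, y}) := by
  refine lt_of_lt_of_le ?_ (excess_le_linearDefect_union hr hC (Finset.insert_nonempty x {y})
    (by simp [hx, hy]))
  rw [excess_pair (Set.mem_iUnion₂.2 ⟨s, hs, hsx⟩) (Set.mem_iUnion₂.2 ⟨t, ht, hty⟩) hxy hadj]
  exact one_pos

theorem exists_anchored_erase_of_linearDefect_ne_zero (h : linearDefect G T ≠ 0) :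
    ∃ u ∈ T, ∃ r ∈ T.erase u, Anchored G {r} (T.erase u) := by
  have hT : 1 < T.card := not_le.1 fun hT => h (linearDefect_eq_zero_of_card_le_one hT)
  rw [linearDefect_eq_sum hT] at h
  obtain ⟨r, hr, hexcess⟩ := Finset.exists_ne_zero_of_sum_ne_zero h
  have hne : (T.erase r).Nonempty := Finset.card_pos.1 (by
    rw [Finset.card_erase_of_mem hr]
    lia)
  have hsum : ∑ u ∈ T.erase r, rootedCoeff G (G.neighborSet r) ((T.erase r).erase u) 0 ≠ 0 := by
    have hpos := (excess_nonneg (G := G) (N := G.neighborSet r) hne).lt_of_ne' hexcess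
    have hcoeff := rootedCoeff_nonneg G (G.neighborSet r) (T.erase r) 0
    rw [excess] at hpos
    lia
  obtain ⟨u, hu, hcoeff⟩ := Finset.exists_ne_zero_of_sum_ne_zero hsum
  obtain ⟨M, -, hM, hanc⟩ := exists_anchored_of_rootedCoeff_ne_zero hcoeff
  have hru : r ∈ T.erase u := Finset.mem_erase.2 ⟨(Finset.ne_of_mem_erase hu).symm, hr⟩
  rw [Finset.card_eq_zero.1 hM, Finset.coe_empty, Set.union_empty, Finset.erase_right_comm,
    ← anchored_singleton_iff hru] at hanc
  exact ⟨u, Finset.mem_of_mem_erase hu, r, hru, hanc⟩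

theorem excess_eq_zero_of_ncard_neighborSet_le_two (hS : ∀ r ∈ S, Anchored G {r} S)
    (hN : ¬Disjoint N S) (hdeg : ∀ v ∈ S, (G.neighborSet v ∩ S).ncard ≤ 2)
    (hroot : ∀ v ∈ S, v ∈ N → (G.neighborSet v ∩ S).ncard ≤ 1) : excess G N S = 0 := by
  induction N, S using rooted_induction G with
  | empty N => simp at hN
  | disjoint N S _ hd _ => exact absurd hd hN
  | mem N S v hvN hv ih_diff ih_erase =>
    rcases (S.erase v).eq_empty_or_nonempty with hempty | ⟨w, hw⟩
    · obtain rfl : S = {v} := by rw [← Finset.insert_erase hv, hempty, insert_empty_eq]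
      exact excess_singleton_of_mem hvN
    have hcard : 1 < S.card := Finset.one_lt_card.2
      ⟨w, Finset.mem_of_mem_erase hw, v, hv, Finset.ne_of_mem_erase hw⟩
    have hdiff : excess G (N \ {v}) S = 0 := by
      by_cases hd : Disjoint (N \ {v}) S
      · exact excess_of_disjoint hd hcard
      · exact ih_diff hS hd hdeg fun u hu huN => hroot u hu huN.1
    have herase : ∀ u, (G.neighborSet u ∩ ↑(S.erase v)) = (G.neighborSet u ∩ S) \ {v} := fun u => by
      rw [Finset.coe_erase, Set.inter_sdiff_assoc]
    rw [excess_of_mem hvN hv, hdiff, zero_add]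
    have hle : ∀ u, (G.neighborSet u ∩ ↑(S.erase v)).ncard ≤ (G.neighborSet u ∩ S).ncard :=
      fun u => by rw [herase]; exact Set.ncard_sdiff_singleton_le _ _
    refine ih_erase (fun r hr => ?_) (Set.not_disjoint_iff.2 ?_)
      (fun u hu => (hle u).trans (hdeg u (Finset.mem_of_mem_erase hu))) (fun u hu huN => ?_)
    · exact (hS r (Finset.mem_of_mem_erase hr)).erase_of_subsingleton hv
        (Finset.ne_of_mem_erase hr).symm ((Set.ncard_le_one_iff_subsingleton).1 (hroot v hv hvN))
    · obtain ⟨u, hu, huv⟩ := ((anchored_singleton_iff hv).1 (hS v hv)).exists_mem ⟨w, hw⟩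
      exact ⟨u, Or.inr huv, hu⟩
    · have huS := Finset.mem_of_mem_erase hu
      rcases huN with huN | hvu
      · exact (hle u).trans (hroot u huS huN)
      · have hvu : v ∈ G.neighborSet u ∩ ↑S := ⟨hvu.symm, hv⟩
        rw [herase, Set.ncard_sdiff_singleton_of_mem hvu]
        exact Nat.sub_le_of_le_add (hdeg u huS)

end Positivity

section Components

variable {V : Type*} {G : SimpleGraph V} {N : Set V} {S : Finset V} {r : V}

theorem connected_of_card_connectedComponent_eq_one (h : Nat.card G.ConnectedComponent = 1) :
    G.Connected := by
  obtain ⟨_, ⟨c⟩⟩ := Nat.card_eq_one_iff_unique.1 h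
  obtain ⟨v, -⟩ := c.exists_rep
  have : Nonempty V := ⟨v⟩
  exact ⟨fun v w => SimpleGraph.ConnectedComponent.exact (Subsingleton.elim _ _)⟩

theorem anchored_of_forall_reachable (hS : ∀ u ∈ S, ∀ w, G.Adj u w → w ∈ S)
    (h : ∀ v ∈ S, ∃ r ∈ N, G.Reachable v r) : Anchored G N S := by
  intro U hU ⟨u, hu⟩
  obtain ⟨r, hr, ⟨p⟩⟩ := h u (hU hu)
  by_cases hrU : r ∈ U
  · exact ⟨r, hrU, Or.inl hr⟩
  · obtain ⟨e, -, hfst, hsnd⟩ := p.exists_boundary_dart U hu hrU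
    exact ⟨e.fst, hfst, Or.inr ⟨e.snd, hS _ (hU hfst) _ e.adj, hsnd, e.adj⟩⟩

theorem Anchored.exists_reachable (h : Anchored G N S) {v : V} (hv : v ∈ S) :
    ∃ r ∈ N, G.Reachable v r := by
  classical
  obtain ⟨u, hu, hN | ⟨w, hw, hwU, huw⟩⟩ := h (S.filter (G.Reachable v)) (Finset.filter_subset _ _)
    ⟨v, Finset.mem_filter.2 ⟨hv, SimpleGraph.Reachable.refl v⟩⟩
  all_goals rw [Finset.mem_filter] at hu
  · exact ⟨u, hN, hu.2⟩
  · exact absurd (Finset.mem_filter.2 ⟨hw, hu.2.trans huw.reachable⟩) hwU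

variable [Fintype V]

theorem anchored_univ_of_connected (hG : G.Connected) (r : V) : Anchored G {r} Finset.univ :=
  anchored_of_forall_reachable (fun _ _ w _ => Finset.mem_univ w)
    fun v _ => ⟨r, rfl, hG.preconnected v r⟩

theorem card_connectedComponent_le (h : Anchored G N Finset.univ) :
    Nat.card G.ConnectedComponent ≤ N.ncard := by
  rw [← Nat.card_coe_set_eq]
  refine Nat.card_le_card_of_surjective (fun v : N => G.connectedComponentMk v) fun c => ?_
  obtain ⟨v, rfl⟩ := c.exists_rep
  obtain ⟨r, hr, hvr⟩ := h.exists_reachable (Finset.mem_univ v)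
  exact ⟨⟨r, hr⟩, SimpleGraph.ConnectedComponent.sound hvr.symm⟩

theorem exists_anchored_representatives (G : SimpleGraph V) :
    ∃ R : Finset V, R.card = Nat.card G.ConnectedComponent ∧ Anchored G R Finset.univ ∧
      ∀ r ∈ R, ∀ r' ∈ R, G.Reachable r r' → r = r' := by
  classical
  have : Fintype G.ConnectedComponent := Fintype.ofFinite _
  have hout : ∀ c : G.ConnectedComponent, G.connectedComponentMk c.out = c := Quot.out_eq
  refine ⟨Finset.univ.image fun c : G.ConnectedComponent => c.out, ?_, ?_, ?_⟩
  · rw [Finset.card_image_of_injective _ (Function.LeftInverse.injective hout), Finset.card_univ,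
      Nat.card_eq_fintype_card]
  · exact anchored_of_forall_reachable (fun _ _ w _ => Finset.mem_univ w) fun v _ =>
      ⟨_, Finset.mem_image_of_mem _ (Finset.mem_univ (G.connectedComponentMk v)),
        SimpleGraph.ConnectedComponent.exact (hout _).symm⟩
  · intro r hr r' hr' h
    obtain ⟨c, -, rfl⟩ := Finset.mem_image.1 hr
    obtain ⟨c', -, rfl⟩ := Finset.mem_image.1 hr'
    rw [← hout c, ← hout c', SimpleGraph.ConnectedComponent.sound h]

open Classical in
/-- The vertex set of the connected component of `r`, as a `Finset`. -/
noncomputable def component (G : SimpleGraph V) (r : V) : Finset V :=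
  Finset.univ.filter (G.Reachable r)

theorem mem_component {v : V} : v ∈ component G r ↔ G.Reachable r v := by
  simp [component]

theorem mem_component_self : r ∈ component G r :=
  mem_component.2 (SimpleGraph.Reachable.refl r)

theorem mem_component_of_adj {u w : V} (hu : u ∈ component G r) (huw : G.Adj u w) :
    w ∈ component G r :=
  mem_component.2 ((mem_component.1 hu).trans huw.reachable)

theorem anchored_component (G : SimpleGraph V) (r : V) : Anchored G {r} (component G r) :=
  anchored_of_forall_reachable (fun _ hu _ huw => mem_component_of_adj hu huw)
    fun _ hv => ⟨r, rfl, (mem_component.1 hv).symm⟩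

theorem Anchored.compl_component [DecidableEq V] (h : Anchored G N Finset.univ) :
    Anchored G (N \ {r}) (component G r)ᶜ := by
  refine (h.subset (Finset.subset_univ _) fun u hu w _ huw => ?_).mono fun v hv hvN =>
    ⟨hvN, fun hvr => Finset.mem_compl.1 hv (hvr ▸ mem_component_self)⟩
  exact Finset.mem_compl.2 fun hw => Finset.mem_compl.1 hu (mem_component_of_adj hw huw.symm)

end Components

section TwoRegular

variable {V W : Type*} {G : SimpleGraph V} {H : SimpleGraph W}

theorem adj_of_injective_hom [Finite V] (f : H →g G) (hf : Function.Injective f) {v w : W}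
    (hv : (G.neighborSet (f v)).ncard ≤ (H.neighborSet v).ncard) (hvw : G.Adj (f v) (f w)) :
    H.Adj v w := by
  have himage : f '' H.neighborSet v = G.neighborSet (f v) :=
    Set.eq_of_subset_of_ncard_le (Set.image_subset_iff.2 fun w hw => f.map_adj hw)
      (by rwa [Set.ncard_image_of_injective _ hf])
  obtain ⟨w', hw', heq⟩ : f w ∈ f '' H.neighborSet v := himage ▸ hvw
  exact hf heq ▸ hw'

theorem ncard_neighborSet_cycleGraph (m : ℕ) (v : Fin (m + 3)) :
    ((SimpleGraph.cycleGraph (m + 3)).neighborSet v).ncard = 2 := by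
  rw [← Nat.card_coe_set_eq, Nat.card_eq_fintype_card, SimpleGraph.card_neighborSet_eq_degree,
    SimpleGraph.cycleGraph_degree_three_le]

theorem eq_top_of_iso_cycleGraph {n : ℕ} (e : G ≃g SimpleGraph.cycleGraph n) (hn : n < 3) :
    G = ⊤ := by
  have htop : SimpleGraph.cycleGraph n = ⊤ := by
    interval_cases n
    · exact SimpleGraph.cycleGraph_zero_eq_top
    · exact SimpleGraph.cycleGraph_one_eq_top
    · exact SimpleGraph.cycleGraph_two_eq_top
  refine top_le_iff.1 fun x y hxy => e.map_adj_iff.1 ?_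
  simp only [htop, SimpleGraph.top_adj]
  exact e.injective.ne hxy

theorem exists_isCycle_length_eq_card [Finite V] (hG : G.Connected)
    (h : ∀ v, (G.neighborSet v).ncard = 2) :
    ∃ (v : V) (p : G.Walk v v), p.IsCycle ∧ p.length = Nat.card V := by
  classical
  have := Fintype.ofFinite V
  have hcycles : G.IsCycles := fun v _ => h v
  obtain ⟨v⟩ := hG.nonempty
  obtain ⟨p, hp, hverts⟩ := hcycles.exists_cycle_toSubgraph_verts_eq_connectedComponentSupp
    (c := G.connectedComponentMk v) (v := v) rfl (Set.nonempty_of_ncard_ne_zero (by simp [h]))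
  have htail : p.support.tail.toFinset = Finset.univ := by
    refine Finset.eq_univ_of_forall fun w => List.mem_toFinset.2 ?_
    have hw : w ∈ p.toSubgraph.verts := by
      rw [hverts]
      exact SimpleGraph.ConnectedComponent.sound (hG.preconnected w v)
    rw [SimpleGraph.Walk.mem_verts_toSubgraph, ← SimpleGraph.Walk.cons_tail_support,
      List.mem_cons] at hw
    rcases hw with rfl | hw
    · exact SimpleGraph.Walk.end_mem_tail_support hp.not_nil
    · exact hw
  refine ⟨v, p, hp, ?_⟩
  rw [Nat.card_eq_fintype_card, ← Finset.card_univ, ← htail,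
    List.toFinset_card_of_nodup hp.support_nodup, List.length_tail,
    SimpleGraph.Walk.length_support, Nat.add_sub_cancel]

theorem nonempty_iso_cycleGraph [Finite V] (hG : G.Connected)
    (h : ∀ v, (G.neighborSet v).ncard = 2) :
    Nonempty (G ≃g SimpleGraph.cycleGraph (Nat.card V)) := by
  have := Fintype.ofFinite V
  obtain ⟨v, p, hp, hlen⟩ := exists_isCycle_length_eq_card hG h
  obtain ⟨m, hm⟩ := Nat.exists_eq_add_of_le' hp.three_le_length
  rw [← hlen, hm]
  obtain ⟨f⟩ := (SimpleGraph.cycleGraph_isContained_iff (G := G) (n := m + 3) (by lia)).2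
    ⟨v, p, hp, hm⟩
  have hbij : Function.Bijective f.toHom := (Fintype.bijective_iff_injective_and_card _).2
    ⟨f.injective, by rw [Fintype.card_fin, ← hm, hlen, Nat.card_eq_fintype_card]⟩
  refine ⟨SimpleGraph.Iso.symm ⟨Equiv.ofBijective f.toHom hbij, fun {v w} => ⟨?_, f.toHom.map_adj⟩⟩⟩
  exact adj_of_injective_hom f.toHom f.injective
    (by rw [h, ncard_neighborSet_cycleGraph])

theorem nonempty_iso_cycleGraph_iff [Finite V] (hG : G ≠ ⊤) :
    Nonempty (G ≃g SimpleGraph.cycleGraph (Nat.card V)) ↔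
      G.Connected ∧ ∀ v, (G.neighborSet v).ncard = 2 := by
  refine ⟨fun ⟨e⟩ => ?_, fun h => nonempty_iso_cycleGraph h.1 h.2⟩
  obtain ⟨m, hm⟩ := Nat.exists_eq_add_of_le'
    (not_lt.1 fun hn => hG (eq_top_of_iso_cycleGraph e hn) : 3 ≤ Nat.card V)
  rw [hm] at e
  refine ⟨e.connected_iff.2 SimpleGraph.cycleGraph_connected, fun v => ?_⟩
  rw [← Nat.card_coe_set_eq, Nat.card_congr (e.mapNeighborSet v), Nat.card_coe_set_eq,
    ncard_neighborSet_cycleGraph]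

variable [Fintype V] [DecidableEq V]

theorem anchored_compl_singleton_of_ncard_eq_two (hG : G.Connected)
    (h : ∀ v, (G.neighborSet v).ncard = 2) {r s : V} (hs : s ≠ r) : Anchored G {s} {r}ᶜ := by
  intro U hU hne
  by_contra! hclosed
  have hsU : s ∉ U := fun hsU => (hclosed s hsU).1 rfl
  have hanc : Anchored G (G.neighborSet r) {r}ᶜ := by
    rw [Finset.compl_singleton]
    exact (anchored_singleton_iff (Finset.mem_univ r)).1 (anchored_univ_of_connected hG r)
  obtain ⟨b, hb, hrb⟩ := (hanc.subset hU fun u hu w hw huw => by_contra fun hwU =>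
    (hclosed u hu).2 w hw hwU huw).exists_mem hne
  obtain ⟨a, ha, hra⟩ := (hanc.subset (S' := {r}ᶜ \ U) Finset.sdiff_subset fun u hu w hw huw =>
    Finset.mem_sdiff.2 ⟨hw, fun hwU => (hclosed w hwU).2 u (Finset.mem_sdiff.1 hu).1
      (Finset.mem_sdiff.1 hu).2 huw.symm⟩).exists_mem
    ⟨s, Finset.mem_sdiff.2 ⟨by simpa using hs, hsU⟩⟩
  have haU := (Finset.mem_sdiff.1 ha).2
  have hab : a ≠ b := fun hab => haU (hab ▸ hb)
  have hneighbors : {a, b} = G.neighborSet r := Set.eq_of_subset_of_ncard_le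
    (Set.pair_subset hra hrb) (by rw [h, Set.ncard_pair hab])
  -- The edge `rb` lies on a cycle, which joins `b` to `a` without passing through `r`.
  obtain ⟨p⟩ := SimpleGraph.IsCycles.reachable_deleteEdges hrb fun v _ => h v
  obtain ⟨e, -, hfst, hsnd⟩ := p.exists_boundary_dart (↑U)ᶜ
    (fun hrU => by simpa using hU hrU) (fun hbU => hbU hb)
  rw [Set.notMem_compl_iff, Finset.mem_coe] at hsnd
  obtain ⟨hadj, hedge⟩ := SimpleGraph.deleteEdges_adj.1 e.adj
  have hfst_eq : e.fst = r := by_contra fun hne =>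
    (hclosed e.snd hsnd).2 e.fst (by simpa using hne) hfst hadj.symm
  rw [hfst_eq] at hadj hedge
  have hmem : e.snd ∈ ({a, b} : Set V) := hneighbors ▸ hadj
  rcases hmem with hsnd_eq | hsnd_eq
  · exact haU (hsnd_eq ▸ hsnd)
  · exact hedge (by rw [hsnd_eq]; rfl)

theorem linearDefect_univ_eq_zero (hG : G.Connected) (h : ∀ v, (G.neighborSet v).ncard = 2) :
    linearDefect G Finset.univ = 0 := by
  rcases le_or_gt (Finset.univ : Finset V).card 1 with hcard | hcard
  · exact linearDefect_eq_zero_of_card_le_one hcard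
  rw [linearDefect_eq_sum hcard]
  refine Finset.sum_eq_zero fun r hr => ?_
  have hanc := (anchored_singleton_iff hr).1 (anchored_univ_of_connected hG r)
  obtain ⟨w, hw, hrw⟩ := hanc.exists_mem (Finset.card_pos.1 (by
    rw [Finset.card_erase_of_mem hr]
    lia))
  refine excess_eq_zero_of_ncard_neighborSet_le_two (fun s hs => ?_)
    (Set.not_disjoint_iff.2 ⟨w, hrw, hw⟩)
    (fun v _ => (Set.ncard_le_ncard Set.inter_subset_left).trans (h v).le) fun v _ hvr => ?_
  · rw [← Finset.compl_singleton]
    exact anchored_compl_singleton_of_ncard_eq_two hG h (Finset.ne_of_mem_erase hs)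
  · have hmem : r ∈ G.neighborSet v := hvr.symm
    calc (G.neighborSet v ∩ ↑(Finset.univ.erase r)).ncard
        = (G.neighborSet v \ {r}).ncard := by
          rw [Finset.coe_erase, Finset.coe_univ, ← Set.inter_sdiff_assoc, Set.inter_univ]
      _ ≤ 1 := by rw [Set.ncard_sdiff_singleton_of_mem hmem, h]

end TwoRegular

section RemovablePair

variable {V : Type*} {G : SimpleGraph V} {N : Set V} {S : Finset V} [DecidableEq V]

theorem exists_nonadjacent_of_not_anchored {z : V} (hS : Anchored G N S) (hz : z ∈ S)
    (h : ¬Anchored G {z} S) : ∃ x₁ ∈ S, ∃ x₂ ∈ S, x₁ ≠ x₂ ∧ ¬G.Adj x₁ x₂ ∧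
      Anchored G N (S \ {x₁, x₂}) := by
  have exists_erase : ∀ U ⊆ S, U.Nonempty → (∀ u ∈ U, ∀ w ∈ S, G.Adj u w → w ∈ U) →
      ∃ x ∈ U, Anchored G N (U.erase x) := fun U hU hne hclosed => by
    simpa using (hS.subset hU hclosed).exists_erase (anchored_empty G N)
      (Finset.empty_ssubset.2 hne)
  simp only [Anchored, not_forall, not_exists, not_and, not_or] at h
  obtain ⟨U, hU, hne, hcut⟩ := h
  obtain ⟨x₁, hx₁, h₁⟩ := exists_erase U hU hne fun u hu w hw huw =>
    by_contra fun hwU => (hcut u hu).2 w hw hwU huw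
  obtain ⟨x₂, hx₂, h₂⟩ := exists_erase (S \ U) Finset.sdiff_subset
    ⟨z, Finset.mem_sdiff.2 ⟨hz, fun hzU => (hcut z hzU).1 rfl⟩⟩ fun u hu w hw huw => by
      rw [Finset.mem_sdiff] at hu ⊢
      exact ⟨hw, fun hwU => (hcut w hwU).2 u hu.1 hu.2 huw.symm⟩
  rw [Finset.mem_sdiff] at hx₂
  refine ⟨x₁, hU hx₁, x₂, hx₂.1, fun heq => hx₂.2 (heq ▸ hx₁),
    (hcut x₁ hx₁).2 x₂ hx₂.1 hx₂.2, ?_⟩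
  have hunion : U.erase x₁ ∪ (S \ U).erase x₂ = S \ {x₁, x₂} := by
    ext v
    have := @hU v
    simp only [Finset.mem_union, Finset.mem_erase, Finset.mem_sdiff, Finset.mem_insert,
      Finset.mem_singleton]
    grind
  simpa only [Set.union_self, hunion] using h₁.union h₂

variable [Fintype V]

/-- `x` and `y` are distinct nonadjacent vertices, and deleting both leaves a nonempty connected
graph. A connected noncomplete graph has such a pair unless it is a cycle. -/
def RemovablePair (G : SimpleGraph V) (x y : V) : Prop :=
  x ≠ y ∧ ¬G.Adj x y ∧ ∃ r ∈ ({x, y}ᶜ : Finset V), Anchored G {r} {x, y}ᶜ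

theorem removablePair_of_anchored {x y r : V} (hxy : x ≠ y) (hadj : ¬G.Adj x y) (hxr : x ≠ r)
    (hyr : y ≠ r) (h : Anchored G (G.neighborSet r) ({r}ᶜ \ {x, y})) : RemovablePair G x y := by
  have hr : r ∈ ({x, y}ᶜ : Finset V) := by simp [hxr.symm, hyr.symm]
  refine ⟨hxy, hadj, r, hr, (anchored_singleton_iff hr).2 ?_⟩
  convert h using 1
  ext v
  simp [and_comm]

theorem anchored_compl_singleton_of_connected (hG : G.Connected)
    (hpair : ∀ x y, ¬RemovablePair G x y) {v z : V} (hzv : z ≠ v) : Anchored G {z} {v}ᶜ := by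
  by_contra h
  have hanc : Anchored G (G.neighborSet v) {v}ᶜ := by
    rw [Finset.compl_singleton]
    exact (anchored_singleton_iff (Finset.mem_univ v)).1 (anchored_univ_of_connected hG v)
  obtain ⟨x₁, hx₁, x₂, hx₂, hne, hadj, hanc'⟩ :=
    exists_nonadjacent_of_not_anchored hanc (by simpa using hzv) h
  exact hpair x₁ x₂
    (removablePair_of_anchored hne hadj (by simpa using hx₁) (by simpa using hx₂) hanc')

theorem exists_not_adj (hG : G ≠ ⊤) (hpair : ∀ x y, ¬RemovablePair G x y) (v : V) :
    ∃ y ≠ v, ¬G.Adj v y := by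
  by_contra! h
  refine hG (top_le_iff.1 fun x y hxy => by_contra fun hadj => ?_)
  have hx : x ≠ v := fun hx => hadj (hx ▸ h y (hx ▸ hxy.symm))
  have hy : y ≠ v := fun hy => hadj (hy ▸ (h x (hy ▸ hxy)).symm)
  exact hpair x y (removablePair_of_anchored hxy hadj hx hy
    (anchored_of_subset fun u hu => h u (by simp_all)))

theorem ncard_neighborSet_le_two (hG : G ≠ ⊤) (hconn : G.Connected)
    (hpair : ∀ x y, ¬RemovablePair G x y) (v : V) : (G.neighborSet v).ncard ≤ 2 := by
  obtain ⟨y, hyv, hvy⟩ := exists_not_adj hG hpair v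
  rcases (G.neighborSet v).eq_empty_or_nonempty with hempty | ⟨z, hvz⟩
  · simp [hempty]
  have hz : z ∈ ({v, y}ᶜ : Finset V) := by
    simp [hvz.ne', show z ≠ y from fun hzy => hvy (hzy ▸ hvz)]
  have hanc : Anchored G (G.neighborSet y) {v, y}ᶜ := by
    rw [Finset.pair_comm, Finset.compl_insert]
    exact (anchored_singleton_iff (by simpa using hyv)).1
      (anchored_compl_singleton_of_connected hconn hpair hyv)
  obtain ⟨x₁, hx₁, x₂, hx₂, hne, hadj, hanc'⟩ :=
    exists_nonadjacent_of_not_anchored hanc hz fun h => hpair v y ⟨hyv.symm, hvy, z, hz, h⟩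
  simp only [Finset.mem_compl, Finset.mem_insert, Finset.mem_singleton, not_or] at hx₁ hx₂
  refine (Set.ncard_le_ncard (t := {x₁, x₂}) fun w hvw => by_contra fun hw => ?_).trans
    (Set.ncard_insert_le x₁ {x₂} |>.trans (by simp))
  refine hpair x₁ x₂ (removablePair_of_anchored hne hadj hx₁.2 hx₂.2 ?_)
  have hwS : w ∈ ({v, y}ᶜ \ {x₁, x₂} : Finset V) := by
    have hwy : w ≠ y := fun hwy => hvy (hwy ▸ hvw)
    simpa [hwy, hvw.ne'] using hw
  convert hanc'.insert_of_adj hwS hvw using 1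
  ext u
  simp only [Finset.mem_insert, Finset.mem_sdiff, Finset.mem_compl, Finset.mem_singleton]
  grind

theorem two_le_ncard_neighborSet (hG : G ≠ ⊤) (hconn : G.Connected)
    (hpair : ∀ x y, ¬RemovablePair G x y) (v : V) : 2 ≤ (G.neighborSet v).ncard := by
  obtain ⟨y, hyv, hvy⟩ := exists_not_adj hG hpair v
  obtain ⟨w, -, hvw⟩ := (anchored_univ_of_connected hconn y).exists_adj (Finset.mem_univ v)
    hyv.symm
  have hyw : y ≠ w := fun hyw => hvy (hyw ▸ hvw)
  obtain ⟨w', hw', hvw'⟩ := (anchored_compl_singleton_of_connected hconn hpair hyw).exists_adj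
    (by simpa using hvw.ne) hyv.symm
  exact (Set.one_lt_ncard).2 ⟨w, hvw, w', hvw', fun h => by simp [h] at hw'⟩

theorem ncard_neighborSet_eq_two (hG : G ≠ ⊤) (hconn : G.Connected)
    (hpair : ∀ x y, ¬RemovablePair G x y) (v : V) : (G.neighborSet v).ncard = 2 :=
  le_antisymm (ncard_neighborSet_le_two hG hconn hpair v)
    (two_le_ncard_neighborSet hG hconn hpair v)

end RemovablePair

section Vanishing

variable {V : Type*} [Fintype V] {G : SimpleGraph V} {j : ℕ}

theorem d_one [DecidableEq V] (G : SimpleGraph V) : d G 1 = linearDefect G Finset.univ := by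
  rw [d_eq_sum, Finset.sum_eq_single Finset.univ]
  · simp [rootedCoeff_empty]
  · intro T _ hT
    have hne : Tᶜ.Nonempty := by
      rwa [Finset.nonempty_iff_ne_empty, Ne, Finset.compl_eq_empty_iff]
    rw [rootedCoeff_zero_of_disjoint hne (Set.empty_disjoint _), mul_zero]
  · simp

theorem exists_anchored_compl_of_d_ne_zero [DecidableEq V] (h : d G (j + 1) ≠ 0) :
    ∃ (u : V) (N : Set V), N.ncard ≤ j + 1 ∧ Anchored G N {u}ᶜ := by
  rw [Ne, d_eq_zero_iff] at h
  push Not at h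
  obtain ⟨T, hT, hcoeff⟩ := h
  obtain ⟨M, -, rfl, hM⟩ := exists_anchored_of_rootedCoeff_ne_zero hcoeff
  obtain ⟨u, hu, r, -, hr⟩ := exists_anchored_erase_of_linearDefect_ne_zero hT
  have hunion : Tᶜ ∪ T.erase u = {u}ᶜ := by
    rw [← Finset.insert_erase hu]
    ext v
    simp only [Finset.mem_union, Finset.mem_compl, Finset.mem_erase, Finset.mem_insert,
      Finset.mem_singleton]
    tauto
  refine ⟨u, M ∪ {r}, (Set.ncard_union_le _ _).trans (by simp), ?_⟩
  simpa only [Set.empty_union, hunion] using hM.union hr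

theorem d_card_eq_zero (h : j + 1 = Nat.card V) : d G (j + 1) = 0 := by
  classical
  refine (d_eq_zero_iff G j).2 fun T => or_iff_not_imp_right.2 fun hcoeff => ?_
  obtain ⟨M, hMT, rfl, -⟩ := exists_anchored_of_rootedCoeff_ne_zero hcoeff
  refine linearDefect_eq_zero_of_card_le_one ?_
  have hM := Finset.card_le_card hMT
  have hT := Finset.card_add_card_compl T
  rw [← Nat.card_eq_fintype_card] at hT
  lia

theorem d_eq_zero_of_lt_card_connectedComponent (h : j + 2 < Nat.card G.ConnectedComponent) :
    d G (j + 1) = 0 := by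
  classical
  by_contra hd
  obtain ⟨u, N, hN, hanc⟩ := exists_anchored_compl_of_d_ne_zero hd
  have huniv : Anchored G (insert u N) Finset.univ := by
    rw [← Finset.insert_erase (Finset.mem_univ u), ← Finset.compl_singleton]
    exact (hanc.mono fun v _ => Or.inr).insert_of_mem (Set.mem_insert u N)
  have hc := card_connectedComponent_le huniv
  have hinsert := Set.ncard_insert_le u N
  lia

theorem d_eq_zero_of_not_isIsolated (h : j + 1 < Nat.card G.ConnectedComponent)
    (hG : ∀ v, ¬G.IsIsolated v) : d G (j + 1) = 0 := by
  classical
  by_contra hd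
  obtain ⟨u, N, hN, hanc⟩ := exists_anchored_compl_of_d_ne_zero hd
  obtain ⟨w, huw⟩ : ∃ w, G.Adj u w := by simpa [SimpleGraph.IsIsolated] using hG u
  have huniv : Anchored G N Finset.univ := by
    rw [← Finset.insert_erase (Finset.mem_univ u), ← Finset.compl_singleton]
    exact hanc.insert_of_adj (by simpa using huw.ne') huw
  have hc := card_connectedComponent_le huniv
  lia

theorem d_one_eq_zero_of_iso_cycleGraph (hG : G ≠ ⊤)
    (he : Nonempty (G ≃g SimpleGraph.cycleGraph (Nat.card V))) : d G 1 = 0 := by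
  classical
  obtain ⟨hconn, hreg⟩ := (nonempty_iso_cycleGraph_iff hG).1 he
  rw [d_one, linearDefect_univ_eq_zero hconn hreg]

end Vanishing

section Nonvanishing

variable {V : Type*} [Fintype V] {G : SimpleGraph V} {j : ℕ}

theorem d_ne_zero [DecidableEq V] {N : Set V} {T : Finset V} (hT : 0 < linearDefect G T)
    (h : Anchored G N Tᶜ) (hN : N.ncard ≤ j) (hj : j ≤ Tᶜ.card) : d G (j + 1) ≠ 0 := by
  rw [Ne, d_eq_zero_iff]
  exact fun h0 => (h0 T).elim hT.ne' (rootedCoeff_pos_of_ncard_le h hN hj).ne'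

theorem linearDefect_pair_pos [DecidableEq V] {x y : V} (hxy : x ≠ y) (hadj : ¬G.Adj x y) :
    0 < linearDefect G {x, y} :=
  linearDefect_insert_pos (Finset.mem_singleton_self y) (anchored_of_subset (by simp))
    (by simpa using hxy) (by simpa using fun h => hadj h.symm)

theorem erase_subset_compl_component [DecidableEq V] {R : Finset V} {r : V}
    (hR : ∀ r' ∈ R, G.Reachable r r' → r = r') : R.erase r ⊆ (component G r)ᶜ := fun v hv =>
  Finset.mem_compl.2 fun hvr => Finset.ne_of_mem_erase hv
    (hR v (Finset.mem_of_mem_erase hv) (mem_component.1 hvr)).symm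

theorem d_ne_zero_of_isIsolated (hc : j + 2 = Nat.card G.ConnectedComponent) {v : V}
    (hv : G.IsIsolated v) : d G (j + 1) ≠ 0 := by
  classical
  obtain ⟨R, hRcard, hR, hRinj⟩ := exists_anchored_representatives G
  have hvR : v ∈ R := by_contra fun hvR =>
    let ⟨w, _, hvw⟩ := hR.exists_adj (Finset.mem_univ v) hvR
    hv w hvw
  obtain ⟨r, hr, hrv⟩ := Finset.exists_mem_ne (by lia : 1 < R.card) v
  have hsub := erase_subset_compl_component (hRinj r hr)
  have hvr : v ∈ R.erase r := Finset.mem_erase.2 ⟨hrv.symm, hvR⟩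
  have hcard : ((R.erase r).erase v).card = j := by
    rw [Finset.card_erase_of_mem hvr, Finset.card_erase_of_mem hr]
    lia
  have hanc := (anchored_iff_of_mem (N := R \ {r}) ⟨hvR, hrv.symm⟩ (hsub hvr)).1 hR.compl_component
  refine d_ne_zero (N := ((R.erase r).erase v : Finset V)) (linearDefect_insert_pos
    mem_component_self (anchored_component G r) (Finset.mem_compl.1 (hsub hvr))
    fun w _ hwv => hv w hwv.symm) ?_ ?_ ?_
  · rw [Finset.compl_insert]
    refine hanc.mono fun u hu h => ?_
    rcases h with h | h
    · simpa [Finset.ne_of_mem_erase hu, and_comm] using h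
    · exact absurd h (hv u)
  · rw [Set.ncard_coe_finset, hcard]
  · rw [Finset.compl_insert, ← hcard]
    exact Finset.card_le_card (Finset.erase_subset_erase v hsub)

theorem d_card_connectedComponent_ne_zero (hj : j ≠ 0)
    (hc : Nat.card G.ConnectedComponent = j + 1) (hV : j + 1 < Nat.card V) :
    d G (j + 1) ≠ 0 := by
  classical
  obtain ⟨R, hRcard, hR, hRinj⟩ := exists_anchored_representatives G
  rw [hc] at hRcard
  rw [Nat.card_eq_fintype_card, ← Finset.card_univ] at hV
  obtain ⟨w, -, hw⟩ := Finset.exists_mem_notMem_of_card_lt_card (hRcard ▸ hV)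
  obtain ⟨r, hr, hrw⟩ : ∃ r ∈ R, ¬G.Reachable r w := by
    by_contra! h
    obtain ⟨x, hx, y, hy, hxy⟩ := Finset.one_lt_card.1 (by lia : 1 < R.card)
    exact hxy (hRinj x hx y hy ((h x hx).trans (h y hy).symm))
  have hcard : j + 1 ≤ (component G r)ᶜ.card := by
    rw [← hRcard, ← Finset.card_erase_add_one hr,
      ← Finset.card_insert_of_notMem fun h => hw (Finset.mem_of_mem_erase h)]
    exact Finset.card_le_card (Finset.insert_subset
      (Finset.mem_compl.2 fun h => hrw (mem_component.1 h))
      (erase_subset_compl_component (hRinj r hr)))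
  obtain ⟨y, hy, hanc⟩ := (hR.compl_component (r := r)).exists_erase (anchored_empty G _)
    (Finset.empty_ssubset.2 (Finset.card_pos.1 (by lia)))
  rw [Finset.sdiff_empty] at hy
  have hyr := Finset.mem_compl.1 hy
  refine d_ne_zero (linearDefect_insert_pos mem_component_self (anchored_component G r) hyr
    fun w hw hwy => hyr (mem_component_of_adj hw hwy)) (by rwa [Finset.compl_insert]) ?_ ?_
  · rw [← Finset.coe_erase, Set.ncard_coe_finset, Finset.card_erase_of_mem hr]
    lia
  · rw [Finset.compl_insert, Finset.card_erase_of_mem hy]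
    lia

theorem d_ne_zero_of_card_connectedComponent_le (h2 : 2 ≤ Nat.card G.ConnectedComponent)
    (hc : Nat.card G.ConnectedComponent ≤ j) (hV : j + 1 < Nat.card V) : d G (j + 1) ≠ 0 := by
  classical
  obtain ⟨R, hRcard, hR, hRinj⟩ := exists_anchored_representatives G
  obtain ⟨r, hr, r', hr', hne⟩ := Finset.one_lt_card.1 (by lia : 1 < R.card)
  have hr'C : r' ∈ (component G r)ᶜ :=
    erase_subset_compl_component (hRinj r hr) (Finset.mem_erase.2 ⟨hne.symm, hr'⟩)
  obtain ⟨x, hx, hancx⟩ := (anchored_component G r).exists_erase (anchored_empty G _)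
    (Finset.empty_ssubset.2 ⟨r, mem_component_self⟩)
  obtain ⟨y, hy, hancy⟩ := (hR.compl_component (r := r)).exists_erase (anchored_empty G _)
    (Finset.empty_ssubset.2 ⟨r', hr'C⟩)
  rw [Finset.sdiff_empty] at hx hy
  have hyC := Finset.mem_compl.1 hy
  have hxy : x ≠ y := fun hxy => hyC (hxy ▸ hx)
  have hunion : (component G r).erase x ∪ (component G r)ᶜ.erase y = {x, y}ᶜ := by
    ext v
    simp only [Finset.mem_union, Finset.mem_erase, Finset.mem_compl, Finset.mem_insert,
      Finset.mem_singleton]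
    grind
  refine d_ne_zero (N := {r} ∪ R \ {r}) (linearDefect_pair_pos hxy fun hadj =>
    hyC (mem_component_of_adj hx hadj)) (hunion ▸ hancx.union hancy) ?_ ?_
  · rw [Set.union_sdiff_cancel (by simpa using hr), Set.ncard_coe_finset]
    lia
  · rw [Finset.card_compl, Finset.card_pair hxy, ← Nat.card_eq_fintype_card]
    lia

theorem d_ne_zero_of_disconnected (h2 : 2 ≤ Nat.card G.ConnectedComponent)
    (hc : Nat.card G.ConnectedComponent ≤ j + 1) (hV : j + 1 < Nat.card V) : d G (j + 1) ≠ 0 := by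
  rcases hc.eq_or_lt with hc | hc
  · exact d_card_connectedComponent_ne_zero (by lia) hc hV
  · exact d_ne_zero_of_card_connectedComponent_le h2 (Nat.le_of_lt_succ hc) hV

theorem d_ne_zero_of_removablePair [DecidableEq V] (hG : G.Connected) {x y : V}
    (hxy : RemovablePair G x y) (hV : j + 1 < Nat.card V) : d G (j + 1) ≠ 0 := by
  obtain ⟨hne, hadj, r, hr, hanc⟩ := hxy
  rcases Nat.eq_zero_or_pos j with rfl | hj
  · have exists_adj : ∀ u u', u ≠ r → ¬G.Adj u u' → ∃ w, w ≠ u' ∧ G.Adj w u := fun u u' hur hu =>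
      let ⟨w, _, huw⟩ := (anchored_univ_of_connected hG r).exists_adj (Finset.mem_univ u) hur
      ⟨w, fun h => hu (h ▸ huw), huw.symm⟩
    have hr' : r ≠ x ∧ r ≠ y := by simpa using hr
    obtain ⟨s, hsy, hsx⟩ := exists_adj x y hr'.1.symm hadj
    obtain ⟨t, htx, hty⟩ := exists_adj y x hr'.2.symm fun h => hadj h.symm
    rw [d_one, ← Finset.union_compl {x, y}, Finset.union_comm]
    exact (linearDefect_union_pair_pos hr hanc (by simp) (by simp) hne hadj
      (by simp [hsx.ne, hsy]) hsx (by simp [htx, hty.ne]) hty).ne'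
  · refine d_ne_zero (linearDefect_pair_pos hne hadj) hanc (by rwa [Set.ncard_singleton]) ?_
    rw [Finset.card_compl, Finset.card_pair hne, ← Nat.card_eq_fintype_card]
    lia

theorem linearDefect_pos_of_leaf [DecidableEq V] {S : Finset V} {m x : V} (hm : m ∈ S)
    (hS : Anchored G {m} S) (hx : x ∈ S) (hleaf : G.neighborSet x ∩ S = {m}) (hcard : 3 ≤ S.card) :
    0 < linearDefect G S := by
  have hxm : G.Adj x m := (hleaf.ge rfl).1
  have hmem : m ∈ S.erase x := Finset.mem_erase.2 ⟨hxm.ne', hm⟩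
  have hanc : Anchored G {m} (S.erase x) :=
    hS.erase_of_subsingleton hx hxm.ne (hleaf ▸ Set.subsingleton_singleton)
  have hssubset : {m} ⊂ S.erase x := by
    refine Finset.ssubset_iff_subset_ne.2 ⟨Finset.singleton_subset_iff.2 hmem, fun h => ?_⟩
    have hone := congr_arg Finset.card h
    rw [Finset.card_singleton, Finset.card_erase_of_mem hx] at hone
    lia
  obtain ⟨y, hy, hancy⟩ := hanc.exists_erase (anchored_of_subset (by simp)) hssubset
  obtain ⟨hyS, hym⟩ := Finset.mem_sdiff.1 hy
  obtain ⟨hyx, hyS'⟩ := Finset.mem_erase.1 hyS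
  rw [Finset.mem_singleton] at hym
  obtain ⟨t, ht, hyt⟩ := hanc.exists_adj hyS hym
  have hmC : m ∈ (S.erase x).erase y := Finset.mem_erase.2 ⟨fun h => hym h.symm, hmem⟩
  have hunion : (S.erase x).erase y ∪ {x, y} = S := by
    ext v
    simp only [Finset.mem_union, Finset.mem_erase, Finset.mem_insert, Finset.mem_singleton]
    grind
  rw [← hunion]
  exact linearDefect_union_pair_pos hmC hancy (by simp) (by simp) hyx.symm
    (fun hxy => hym (hleaf.le ⟨hxy, hyS'⟩)) hmC hxm.symm (Finset.mem_erase.2 ⟨hyt.ne', ht⟩) hyt.symm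

theorem d_two_ne_zero_of_ncard_neighborSet_eq_two (hG : G.Connected)
    (h : ∀ v, (G.neighborSet v).ncard = 2) {x y : V} (hxy : x ≠ y) (hadj : ¬G.Adj x y) :
    d G 2 ≠ 0 := by
  classical
  obtain ⟨v, m, hvm, hx⟩ := Set.ncard_eq_two.1 (h x)
  have hxv : G.Adj x v := hx.ge (by simp)
  have hxm : G.Adj x m := hx.ge (by simp)
  have hcard : 4 ≤ Nat.card V := by
    have hyv : y ≠ v := fun h => hadj (h ▸ hxv)
    have hym : y ≠ m := fun h => hadj (h ▸ hxm)
    have h4 : ({x, y, v, m} : Finset V).card = 4 := by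
      simp [Finset.card_insert_of_notMem, hxy, hxv.ne, hxm.ne, hyv, hym, hvm]
    rw [← h4, Nat.card_eq_fintype_card]
    exact Finset.card_le_univ _
  refine d_ne_zero (linearDefect_pos_of_leaf (S := {v}ᶜ) (m := m) (x := x)
    (by simpa using hvm.symm) (anchored_compl_singleton_of_ncard_eq_two hG h hvm.symm)
    (by simpa using hxv.ne) ?_ ?_) (anchored_of_subset (N := {v}) (by simp)) (by simp) (by simp)
  · rw [hx, Finset.coe_compl, Finset.coe_singleton, ← Set.sdiff_eq]
    exact Set.insert_sdiff_self_of_notMem (by simpa using hvm)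
  · rw [Finset.card_compl, Finset.card_singleton, ← Nat.card_eq_fintype_card]
    lia

theorem d_ne_zero_of_ncard_neighborSet_eq_two (hG : G.Connected)
    (h : ∀ v, (G.neighborSet v).ncard = 2) {x y : V} (hxy : x ≠ y) (hadj : ¬G.Adj x y)
    (hj : 2 ≤ j) (hV : j + 1 < Nat.card V) : d G (j + 1) ≠ 0 := by
  classical
  refine d_ne_zero (N := G.neighborSet y) (linearDefect_pair_pos hxy hadj) ?_ ((h y).trans_le hj) ?_
  · rw [Finset.pair_comm, Finset.compl_insert]
    exact (anchored_singleton_iff (by simpa using hxy.symm)).1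
      (anchored_compl_singleton_of_ncard_eq_two hG h hxy.symm)
  · rw [Finset.card_compl, Finset.card_pair hxy, ← Nat.card_eq_fintype_card]
    lia

theorem d_ne_zero_of_connected (hG : G ≠ ⊤) (hconn : G.Connected) (hV : j + 1 < Nat.card V)
    (h : j = 0 → ¬∀ v, (G.neighborSet v).ncard = 2) : d G (j + 1) ≠ 0 := by
  classical
  by_cases hpair : ∃ x y, RemovablePair G x y
  · obtain ⟨x, y, hxy⟩ := hpair
    exact d_ne_zero_of_removablePair hconn hxy hV
  push Not at hpair
  have hreg := ncard_neighborSet_eq_two hG hconn hpair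
  obtain ⟨x, y, hxy, hadj⟩ := SimpleGraph.ne_top_iff_exists_not_adj.1 hG
  rcases Nat.lt_or_ge 1 j with hj | hj
  · exact d_ne_zero_of_ncard_neighborSet_eq_two hconn hreg hxy hadj hj hV
  · obtain rfl : j = 1 := le_antisymm hj (Nat.pos_of_ne_zero fun hj0 => h hj0 hreg)
    exact d_two_ne_zero_of_ncard_neighborSet_eq_two hconn hreg hxy hadj

end Nonvanishing

end ChromaticCoeff

theorem mainTheorem5 {V : Type*} [Fintype V] (G : SimpleGraph V) (hG : G ≠ ⊤)
    (n c : ℕ) (hn : n = Nat.card V) (hc : c = Nat.card G.ConnectedComponent) :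
    ∀ i : ℕ, 1 ≤ i → i ≤ n →
      0 ≤ ChromaticCoeff.d G i ∧
      (ChromaticCoeff.d G i = 0 ↔
        i = n ∨
        i + 2 ≤ c ∨
        (i + 1 = c ∧ ∀ v : V, ¬ G.IsIsolated v) ∨
        (i = 1 ∧ c = 1 ∧ Nonempty (G ≃g SimpleGraph.cycleGraph n))) := by
  intro i hi hin
  obtain ⟨j, rfl⟩ := Nat.exists_eq_add_of_le' hi
  subst hn hc
  refine ⟨ChromaticCoeff.d_nonneg G j, fun h0 => ?_, ?_⟩
  · by_contra! h
    obtain ⟨hn, hc, hiso, hcycle⟩ := h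
    have : Nonempty V := (Nat.card_pos_iff.1 (by lia : 0 < Nat.card V)).1
    have hpos : 0 < Nat.card G.ConnectedComponent := Nat.card_pos
    rcases Nat.lt_or_ge (j + 1) (Nat.card G.ConnectedComponent) with hjc | hjc
    · obtain ⟨v, hv⟩ := hiso (by lia)
      exact ChromaticCoeff.d_ne_zero_of_isIsolated (by lia) hv h0
    rcases Nat.lt_or_ge 1 (Nat.card G.ConnectedComponent) with h1 | h1
    · exact ChromaticCoeff.d_ne_zero_of_disconnected h1 hjc (by lia) h0
    have hc1 : Nat.card G.ConnectedComponent = 1 := le_antisymm h1 hpos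
    have hconn := ChromaticCoeff.connected_of_card_connectedComponent_eq_one hc1
    refine ChromaticCoeff.d_ne_zero_of_connected hG hconn (by lia) (fun hj hreg => ?_) h0
    exact not_nonempty_iff.2 (hcycle (by lia) hc1)
      ((ChromaticCoeff.nonempty_iso_cycleGraph_iff hG).2 ⟨hconn, hreg⟩)
  · rintro (hn | hc | ⟨hc, hiso⟩ | ⟨hj, -, he⟩)
    · exact ChromaticCoeff.d_card_eq_zero hn
    · exact ChromaticCoeff.d_eq_zero_of_lt_card_connectedComponent hc
    · exact ChromaticCoeff.d_eq_zero_of_not_isIsolated (by lia) hiso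
    · rw [hj]
      exact ChromaticCoeff.d_one_eq_zero_of_iso_cycleGraph hG he
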